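/- Let $F$ be a field of characteristic $0$. For a (not necessarily associative, not necessarily unital) $F$-algebra $A$ let $P_n$ be the space of multilinear polynomials in $x_1,\dots,x_n$ in the free nonassociative algebra $F\{X\}$, $X=\{x_1,x_2,\dots\}$, let $\mathrm{Id}(A)\subseteq F\{X\}$ be the ideal of polynomial identities of $A$, and put $$c_n(A)=\dim_F \frac{P_n}{P_n\cap \mathrm{Id}(A)},\qquad \underline{exp}(A)=\liminf_{n\to\infty}\sqrt[n]{c_n(A)},\qquad \overline{exp}(A)=\limsup_{n\to\infty}\sqrt[n]{c_n(A)} .$$ The ordinary PI-exponent of $A$ is $\lim_{n\to\infty}\sqrt[n]{c_n(A)}$, if this limit exists. Let $A^\sharp$ denote the unital algebra obtained from $A$ by adjoining an external unit. For every real $\beta>2$ there is an $F$-algebra $R_\beta$ with exponentially bounded codimension sequence, $\underline{exp}(R_\beta)=1$ and $\overline{exp}(R_\beta)=\beta$, such that the codimension sequence of the unital algebra $R_\beta^\sharp$ is exponentially bounded, the ordinary PI-exponent of $R_\beta^\sharp$ does not exist, $\underline{exp}(R_\beta^\sharp)=2$, and $\beta\le\overline{exp}(R_\beta^\sharp)\le\beta+1$.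 -/

import Mathlib

open Filter Topology

universe u

/-- The multiset of generators occurring in a nonassociative monomial, with multiplicity. -/
def FreeMagma.varMultiset {X : Type*} : FreeMagma X → Multiset X
  | .of x => {x}
  | .mul u v => FreeMagma.varMultiset u + FreeMagma.varMultiset v

/-- Only finitely many nonassociative monomials have a given content. -/
theorem FreeMagma.finite_varMultiset_eq {X : Type*} (s : Multiset X) :
    {w : FreeMagma X | w.varMultiset = s}.Finite := by
  classical
  have pos : ∀ w : FreeMagma X, 0 < Multiset.card w.varMultiset := by
    intro w
    induction w with
    | ih1 x => exact Nat.lt_of_lt_of_eq Nat.one_pos (Multiset.card_singleton x).symm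
    | ih2 u v hu hv =>
      change 0 < Multiset.card (u.varMultiset + v.varMultiset)
      rw [Multiset.card_add]; omega
  induction hn : Multiset.card s using Nat.strong_induction_on generalizing s with
  | _ n ih =>
    let S : Set (Multiset X × Multiset X) :=
      {p | p.1 + p.2 = s ∧ 0 < Multiset.card p.1 ∧ 0 < Multiset.card p.2}
    have hS : S.Finite := (Multiset.antidiagonal s).toFinset.finite_toSet.subset (by
      intro p hp
      simpa using hp.1)
    have h1 : ((FreeMagma.of : X → FreeMagma X) '' {x | x ∈ s}).Finite :=
      (s.toFinset.finite_toSet.subset (by intro x hx; simpa using hx)).image _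
    have h2 : (⋃ p ∈ S, Set.image2 (fun u v : FreeMagma X => u * v)
        {u | u.varMultiset = p.1} {v | v.varMultiset = p.2}).Finite := by
      refine hS.biUnion fun p hp => Set.Finite.image2 _ ?_ ?_
      · refine ih _ ?_ _ rfl
        rw [← hn, ← hp.1, Multiset.card_add]; have := hp.2.2; omega
      · refine ih _ ?_ _ rfl
        rw [← hn, ← hp.1, Multiset.card_add]; have := hp.2.1; omega
    refine (h1.union h2).subset ?_
    intro w hw
    cases w with
    | of x => exact Or.inl ⟨x, by
        have : s = {x} := hw.symm
        simp [this], rfl⟩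
    | mul u v =>
      refine Or.inr ?_
      simp only [Set.mem_iUnion]
      exact ⟨(u.varMultiset, v.varMultiset), ⟨hw, pos u, pos v⟩, u, rfl, v, rfl, rfl⟩

/-- The nonassociative monomial `w` as an element of the free nonassociative algebra `F{X}`. -/
noncomputable def freeMonomial (F : Type*) [Field F] (w : FreeMagma ℕ) :
    FreeNonUnitalNonAssocAlgebra F ℕ :=
  FreeMagma.lift (FreeNonUnitalNonAssocAlgebra.of F) w

/-- The space `P_n` of multilinear polynomials in the first `n` free generators: the span of all
monomials (with every arrangement of brackets) in which each of the generators
`0, …, n - 1` occurs exactly once and no other generator occurs. -/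
noncomputable def multilinearPolys (F : Type*) [Field F] (n : ℕ) :
    Submodule F (FreeNonUnitalNonAssocAlgebra F ℕ) :=
  Submodule.span F (freeMonomial F '' {w | w.varMultiset = Multiset.range n})

/-- `P_n` is finite dimensional, so the dimensions of its quotients are honest numbers. -/
instance multilinearPolys_finite (F : Type*) [Field F] (n : ℕ) :
    Module.Finite F (multilinearPolys F n) :=
  Module.Finite.span_of_finite F ((FreeMagma.finite_varMultiset_eq _).image _)

section Identities

variable (F : Type*) [Field F] (A : Type*) [NonUnitalNonAssocRing A] [Module F A]
  [IsScalarTower F A A] [SMulCommClass F A A]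

/-- `Id(A)`: the polynomials in `F{X}` that vanish under every substitution of elements of the
(not necessarily associative, not necessarily unital) `F`-algebra `A` for the generators. -/
def polyIdentities : Submodule F (FreeNonUnitalNonAssocAlgebra F ℕ) where
  carrier := {f | ∀ v : ℕ → A, FreeNonUnitalNonAssocAlgebra.lift F v f = 0}
  add_mem' := fun hf hg v => by rw [map_add, hf v, hg v, add_zero]
  zero_mem' := fun v => map_zero _
  smul_mem' := fun c f hf v => by rw [map_smul, hf v, smul_zero]

/-- The `n`-th codimension `c_n(A) = dim P_n / (P_n ∩ Id(A))`. -/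
noncomputable def codim (n : ℕ) : ℕ :=
  Module.finrank F
    (multilinearPolys F n ⧸ (polyIdentities F A).submoduleOf (multilinearPolys F n))

/-- The sequence `c_n(A)` is bounded by an exponential function of `n`. -/
def CodimExpBounded : Prop :=
  ∃ C a : ℝ, ∀ n : ℕ, (codim F A n : ℝ) ≤ C * a ^ n

/-- The `n`-th root of the `n`-th codimension. -/
noncomputable def codimRoot (n : ℕ) : ℝ :=
  (codim F A n : ℝ) ^ (1 / (n : ℝ))

/-- The lower PI-exponent. -/
noncomputable def lowerPIExp : ℝ := liminf (codimRoot F A) atTop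

/-- The upper PI-exponent. -/
noncomputable def upperPIExp : ℝ := limsup (codimRoot F A) atTop

/-- The ordinary PI-exponent exists: the `n`-th roots of the codimensions converge. -/
def HasPIExp : Prop := ∃ L : ℝ, Tendsto (codimRoot F A) atTop (𝓝 L)

end Identities

section Unit

variable {F : Type*} [Field F] {A : Type*} [NonUnitalNonAssocRing A] [Module F A]
  [IsScalarTower F A A] [SMulCommClass F A A]

/- Adjoining an external unit to an `F`-algebra gives `Unitization F A`, with its multiplication
`(r, a) (s, b) = (r s, r b + s a + a b)` and unit `(1, 0)`. Mathlib provides the nonassociative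
unital ring and the vector space structure; the compatibility of the two is checked here. -/

instance unitization_isScalarTower :
    IsScalarTower F (Unitization F A) (Unitization F A) where
  smul_assoc c x y := by
    ext
    · simp [mul_assoc]
    · simp [smul_add, smul_smul, smul_mul_assoc, mul_comm]

instance unitization_smulCommClass :
    SMulCommClass F (Unitization F A) (Unitization F A) where
  smul_comm c x y := by
    ext
    · simp [mul_left_comm]
    · simp [smul_add, smul_smul, mul_smul_comm, mul_comm]

end Unit

/-!
The algebra is built from a set of states with one arrow into each state, the arrows being labelled
by letters. The letters act on the states from the right by moving along the arrows, and all other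
products vanish. So only left-normed monomials are nonzero, and a monomial of degree `n` is
determined by the words read along the paths of length `n - 1`: on a path, the value depends on
the generators placed at the letters different from `0`, all remaining generators being evaluated at
the letter `0`. The `n`-th codimension is therefore at most the number of patterns formed by the
positions of these letters, times the number of choices of generators for a pattern
(`PathSystem.finrank_monomialSpan_le`). If the nonzero letters of a word of length `N` are `q`
different ones, it is at least `N (N - 1) ⋯ (N - q + 1)` in degree `N + 1`
(`PathSystem.descFactorial_le_codim`).

The states of `blockSystem` form finite blocks. In block `g` a new letter occurs at every `M`-th
step, where `M = blockGap β g`, and the length `N` of the block is just below `β ^ M`. In degree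
`n` such a block contributes, up to a fixed power of `n`, about `n ^ (n / M)`, which is at most
`β ^ n` for `n ≤ N + 1`, close to `β ^ n` for `n = N + 1`, only polynomial for `n ≤ M`, and `0` for
`n > N + 1`. Each gap exceeds the square of the length of the preceding block, so the codimensions
are polynomially bounded in the degrees `blockGap β (i + 1)`, and the exponents are `1` and `β`. A
loop with the letter `0` keeps the codimensions positive.

For the algebra with adjoined unit, the multilinear expansion of a monomial at `v i = λ i + r i`
gives `c_n(R♯) ≤ 1 + ∑ k, (n choose k) c_k(R)` (`codim_unitization_le`), hence the upper bound
`β + 1`; in degree `blockGap β (i + 1)` all `c_k(R)` on the right are small compared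
with `(1 + ε) ^ n`, which gives the growth rate `2` there. Conversely `c_n(R♯) ≥ 2 ^ (n - 1)`
(`two_pow_le_codim_unitization`), because products of commutators with, and left multiplications
by, the generators tell apart all the ways of substituting `1` or the letter `0`. As `2 < β`, the
lower exponent `2` differs from the upper one, which is at least `β`.
-/

/-! ### Codimensions as dimensions of spaces of functions -/

@[simp] theorem FreeMagma.varMultiset_of {X : Type*} (x : X) :
    (FreeMagma.of x).varMultiset = {x} := rfl

@[simp] theorem FreeMagma.varMultiset_mul {X : Type*} (u v : FreeMagma X) :
    (u * v).varMultiset = u.varMultiset + v.varMultiset := rfl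

theorem FreeMagma.varMultiset_ne_zero {X : Type*} (w : FreeMagma X) : w.varMultiset ≠ 0 := by
  induction w using FreeMagma.recOnMul with
  | ih1 x => simp
  | ih2 u v hu hv => simp [hu]

/-- The function `(ℕ → A) → A` computed by the nonassociative monomial `w` on `A`. -/
def monomialFun (A : Type*) [Mul A] (w : FreeMagma ℕ) : (ℕ → A) → A :=
  fun v => FreeMagma.lift v w

@[simp] theorem monomialFun_of {A : Type*} [Mul A] (i : ℕ) (v : ℕ → A) :
    monomialFun A (FreeMagma.of i) v = v i := rfl

@[simp] theorem monomialFun_mul {A : Type*} [Mul A] (u w : FreeMagma ℕ) (v : ℕ → A) :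
    monomialFun A (u * w) v = monomialFun A u v * monomialFun A w v := by
  simp [monomialFun]

section Codim

variable (F : Type*) [Field F] (A : Type*) [NonUnitalNonAssocRing A] [Module F A]

/-- The space of functions `(ℕ → A) → A` spanned by the monomials of content `s`. -/
def monomialSpan (s : Multiset ℕ) : Submodule F ((ℕ → A) → A) :=
  Submodule.span F (monomialFun A '' {w | w.varMultiset = s})

instance monomialSpan_finite (s : Multiset ℕ) : Module.Finite F (monomialSpan F A s) :=
  Module.Finite.span_of_finite F ((FreeMagma.finite_varMultiset_eq _).image _)

variable {F A} in
theorem monomialFun_mem_monomialSpan (w : FreeMagma ℕ) :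
    monomialFun A w ∈ monomialSpan F A w.varMultiset :=
  Submodule.subset_span ⟨w, rfl, rfl⟩

variable [IsScalarTower F A A] [SMulCommClass F A A]

/-- The polynomial function on `A` defined by an element of the free nonassociative algebra. -/
noncomputable def polyFun : FreeNonUnitalNonAssocAlgebra F ℕ →ₗ[F] ((ℕ → A) → A) where
  toFun f v := FreeNonUnitalNonAssocAlgebra.lift F v f
  map_add' f g := by ext v; simp
  map_smul' c f := by ext v; simp

theorem polyFun_freeMonomial (w : FreeMagma ℕ) :
    polyFun F A (freeMonomial F w) = monomialFun A w := by
  funext v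
  change FreeNonUnitalNonAssocAlgebra.lift F v (freeMonomial F w) = _
  induction w using FreeMagma.recOnMul with
  | ih1 x => simp [freeMonomial]
  | ih2 u w hu hw =>
    rw [monomialFun_mul, ← hu, ← hw, ← map_mul]
    simp [freeMonomial]

theorem ker_polyFun : LinearMap.ker (polyFun F A) = polyIdentities F A := by
  ext f
  exact funext_iff

/-- The `n`-th codimension is the dimension of the space of functions on `A` spanned by the
multilinear monomials. -/
theorem codim_eq_finrank (n : ℕ) :
    codim F A n = Module.finrank F (monomialSpan F A (Multiset.range n)) := by
  have hker : LinearMap.ker ((polyFun F A).comp (multilinearPolys F n).subtype) =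
      (polyIdentities F A).submoduleOf (multilinearPolys F n) := by
    rw [LinearMap.ker_comp, ker_polyFun]; rfl
  have hrange : LinearMap.range ((polyFun F A).comp (multilinearPolys F n).subtype) =
      monomialSpan F A (Multiset.range n) := by
    rw [LinearMap.range_comp, Submodule.range_subtype, multilinearPolys, Submodule.map_span,
      monomialSpan, Set.image_image]
    simp only [polyFun_freeMonomial]
  rw [codim, ← hker, ← hrange]
  exact (LinearMap.quotKerEquivRange _).finrank_eq

end Codim

/-- A family of functions that is dual to a family of evaluation points, up to a linear map `L`
on the values, is linearly independent, so it bounds the dimension of a space containing it. -/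
theorem card_le_finrank_of_dual {F A B X ι : Type*} [Field F] [AddCommGroup A] [Module F A]
    [AddCommGroup B] [Module F B] [Fintype ι] [DecidableEq ι] (W : Submodule F (X → A))
    [Module.Finite F W] (φ : ι → X → A) (hφ : ∀ i, φ i ∈ W) (e : ι → X) (L : A →ₗ[F] B) (b : B)
    (hb : b ≠ 0) (h : ∀ i j, L (φ i (e j)) = if i = j then b else 0) :
    Fintype.card ι ≤ Module.finrank F W := by
  have hli : LinearIndependent F (fun i => (⟨φ i, hφ i⟩ : W)) := by
    rw [Fintype.linearIndependent_iff]
    intro g hg j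
    have h1 := congrArg L (congrFun (congrArg Subtype.val hg) (e j))
    simp [Finset.sum_apply, h] at h1
    exact h1.resolve_right hb
  exact hli.fintype_card_le_finrank

/-! ### Codimensions of the algebra with adjoined unit -/

/-- The monomial obtained from a nonassociative monomial by substituting `1` for all generators
outside `T`; the result is `1` if no generator of the monomial lies in `T`. -/
noncomputable def FreeMagma.restrict {X : Type*} [DecidableEq X] (T : Finset X) :
    FreeMagma X →ₙ* WithOne (FreeMagma X) :=
  FreeMagma.lift fun x => if x ∈ T then (FreeMagma.of x : WithOne (FreeMagma X)) else 1

/-- Restriction to `T` keeps exactly the generators in `T`, and gives `1` if there are none. -/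
theorem FreeMagma.restrict_cases {X : Type*} [DecidableEq X] (T : Finset X) (w : FreeMagma X) :
    (FreeMagma.restrict T w = 1 ∧ w.varMultiset.filter (· ∈ T) = 0) ∨
      ∃ w' : FreeMagma X, FreeMagma.restrict T w = w' ∧
        w'.varMultiset = w.varMultiset.filter (· ∈ T) := by
  induction w using FreeMagma.recOnMul with
  | ih1 x =>
    by_cases hx : x ∈ T
    · exact Or.inr ⟨.of x, by simp [FreeMagma.restrict, hx], by simp [Multiset.filter_singleton, hx]⟩
    · exact Or.inl ⟨by simp [FreeMagma.restrict, hx], by simp [Multiset.filter_singleton, hx]⟩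
  | ih2 u w hu hw =>
    rw [map_mul, FreeMagma.varMultiset_mul, Multiset.filter_add]
    rcases hu with ⟨hu, hu'⟩ | ⟨u', hu, hu'⟩ <;> rcases hw with ⟨hw, hw'⟩ | ⟨w', hw, hw'⟩ <;>
      rw [hu, hw]
    · exact Or.inl ⟨one_mul 1, by rw [hu', hw', add_zero]⟩
    · exact Or.inr ⟨w', one_mul _, by rw [hu', hw', zero_add]⟩
    · exact Or.inr ⟨u', mul_one _, by rw [hu', hw', add_zero]⟩
    · exact Or.inr ⟨u' * w', rfl, by rw [FreeMagma.varMultiset_mul, hu', hw']⟩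

theorem FreeMagma.restrict_congr {X : Type*} [DecidableEq X] {T T' : Finset X} (w : FreeMagma X)
    (h : ∀ x ∈ w.varMultiset, x ∈ T ↔ x ∈ T') :
    FreeMagma.restrict T w = FreeMagma.restrict T' w := by
  induction w using FreeMagma.recOnMul with
  | ih1 x => simp [FreeMagma.restrict, h x (by simp)]
  | ih2 u w hu hw =>
    rw [map_mul, map_mul, hu fun x hx => h x (by simp [hx]), hw fun x hx => h x (by simp [hx])]

/-- Pairs of subsets of two disjoint sets correspond to the subsets of their union. -/
theorem Finset.sum_powerset_disjUnion {α M : Type*} [DecidableEq α] [AddCommMonoid M]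
    {s t : Finset α} (h : Disjoint s t) (f : Finset α → M) :
    ∑ T ∈ (s ∪ t).powerset, f T = ∑ A ∈ s.powerset, ∑ B ∈ t.powerset, f (A ∪ B) := by
  rw [← Finset.sum_product']
  symm
  refine Finset.sum_bij' (fun p _ => p.1 ∪ p.2) (fun T _ => (T ∩ s, T ∩ t)) ?_ ?_ ?_ ?_ ?_
  · intro p hp
    simp only [Finset.mem_product, Finset.mem_powerset] at hp ⊢
    exact Finset.union_subset_union hp.1 hp.2
  · intro T _
    simp [Finset.inter_subset_right]
  · rintro ⟨A, B⟩ hp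
    simp only [Finset.mem_product, Finset.mem_powerset] at hp
    rw [Finset.disjoint_left] at h
    ext x
    · have := @hp.1 x; have := @hp.2 x; have := @h x
      simp only [Finset.mem_inter, Finset.mem_union]; tauto
    · have := @hp.1 x; have := @hp.2 x; have := @h x
      simp only [Finset.mem_inter, Finset.mem_union]; tauto
  · intro T hT
    simp only [Finset.mem_powerset] at hT
    rw [← Finset.inter_union_distrib_left, Finset.inter_eq_left.2 hT]
  · intro p _; rfl

section Unit

variable {F : Type*} [Field F] {A : Type*} [NonUnitalNonAssocRing A] [Module F A]

/-- The value at `r` of a possibly empty monomial, the empty one having the value `1`. -/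
noncomputable def evalWithOne (F : Type*) [Field F] {A : Type*} [NonUnitalNonAssocRing A]
    [Module F A] [IsScalarTower F A A] [SMulCommClass F A A] (r : ℕ → A) :
    WithOne (FreeMagma ℕ) →* Unitization F A :=
  WithOne.lift (FreeMagma.lift fun i => (r i : Unitization F A))

variable [IsScalarTower F A A] [SMulCommClass F A A]

theorem evalWithOne_coe (r : ℕ → A) (w : FreeMagma ℕ) :
    evalWithOne F r w = (monomialFun A w r : Unitization F A) := by
  rw [evalWithOne, WithOne.lift_coe]
  induction w using FreeMagma.recOnMul with
  | ih1 x => simp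
  | ih2 u w hu hw => rw [map_mul, hu, hw, monomialFun_mul, Unitization.inr_mul]

/-- The multilinear expansion of a monomial at the arguments `v i = λ i + r i`. -/
theorem monomialFun_unitization (w : FreeMagma ℕ) (hw : w.varMultiset.Nodup)
    (v : ℕ → Unitization F A) :
    monomialFun (Unitization F A) w v = ∑ T ∈ w.varMultiset.toFinset.powerset,
      (∏ i ∈ w.varMultiset.toFinset \ T, (v i).fst) •
        evalWithOne F (fun i => (v i).snd) (FreeMagma.restrict T w) := by
  induction w using FreeMagma.recOnMul with
  | ih1 x =>
    have hp : (({x} : Multiset ℕ).toFinset).powerset = {∅, {x}} := by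
      rw [Multiset.toFinset_singleton]; rfl
    rw [FreeMagma.varMultiset_of, hp, Finset.sum_pair (by simp)]
    simp only [monomialFun_of, FreeMagma.restrict, FreeMagma.lift_of, Finset.mem_singleton]
    simp only [Finset.notMem_empty, if_false, if_true, map_one, evalWithOne_coe, monomialFun_of,
      Multiset.toFinset_singleton, Finset.sdiff_empty, Finset.prod_singleton, Finset.sdiff_self,
      Finset.prod_empty, one_smul]
    ext <;> simp
  | ih2 u w hu hv =>
    rw [FreeMagma.varMultiset_mul, Multiset.nodup_add] at hw
    obtain ⟨h1, h2, h3⟩ := hw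
    have hd : Disjoint u.varMultiset.toFinset w.varMultiset.toFinset := by
      rw [Multiset.disjoint_toFinset]; exact h3
    rw [monomialFun_mul, hu h1, hv h2, FreeMagma.varMultiset_mul, Multiset.toFinset_add,
      Finset.sum_powerset_disjUnion hd, Finset.sum_mul_sum]
    refine Finset.sum_congr rfl fun T hT => Finset.sum_congr rfl fun T' hT' => ?_
    rw [Finset.mem_powerset] at hT hT'
    rw [Finset.disjoint_left] at hd
    have e1 : FreeMagma.restrict (T ∪ T') u = FreeMagma.restrict T u := by
      refine FreeMagma.restrict_congr u fun x hx => ?_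
      have h4 := @hd x (by simpa using hx)
      have h5 := @hT' x
      simp only [Finset.mem_union]; tauto
    have e2 : FreeMagma.restrict (T ∪ T') w = FreeMagma.restrict T' w := by
      refine FreeMagma.restrict_congr w fun x hx => ?_
      have h4 := @hd x
      have h5 := @hT x
      have h6 : x ∈ w.varMultiset.toFinset := by simpa using hx
      simp only [Finset.mem_union]; tauto
    have e3 : (u.varMultiset.toFinset ∪ w.varMultiset.toFinset) \ (T ∪ T') =
        (u.varMultiset.toFinset \ T) ∪ (w.varMultiset.toFinset \ T') := by
      ext x
      have h4 := @hd x
      have h5 := @hT x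
      have h6 := @hT' x
      simp only [Finset.mem_union, Finset.mem_sdiff]; tauto
    have e4 : Disjoint (u.varMultiset.toFinset \ T) (w.varMultiset.toFinset \ T') := by
      rw [Finset.disjoint_left]
      intro x hx hx'
      exact hd (Finset.mem_sdiff.1 hx).1 (Finset.mem_sdiff.1 hx').1
    rw [map_mul, map_mul, e1, e2, e3, Finset.prod_union e4, smul_mul_smul_comm]

variable (F A)

/-- The sum of a constant polynomial and of one polynomial function on `A` for each set `T` of
generators, evaluated on `A` with adjoined unit, where the generators outside `T` enter through
their scalar parts. -/
noncomputable def unitExpansion (s : Finset ℕ) :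
    (F × ((T : s.powerset) → monomialSpan F A T.1.val)) →ₗ[F]
      ((ℕ → Unitization F A) → Unitization F A) where
  toFun p v := (p.1 * ∏ i ∈ s, (v i).fst) • 1 + ∑ T : s.powerset, (∏ i ∈ s \ T.1, (v i).fst) •
    ((p.2 T).1 (fun i => (v i).snd) : Unitization F A)
  map_add' p q := by
    funext v
    simp only [Prod.fst_add, Prod.snd_add, Pi.add_apply, Submodule.coe_add, Unitization.inr_add,
      smul_add, Finset.sum_add_distrib, add_mul, add_smul]
    abel
  map_smul' c p := by
    funext v
    simp only [Prod.smul_fst, Prod.smul_snd, Pi.smul_apply, Submodule.coe_smul, smul_add,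
      Finset.smul_sum, RingHom.id_apply, smul_eq_mul, Unitization.inr_smul, mul_smul]
    congr 1
    exact Finset.sum_congr rfl fun T _ => smul_comm _ _ _

theorem monomialSpan_unitization_le (s : Finset ℕ) :
    monomialSpan F (Unitization F A) s.val ≤ LinearMap.range (unitExpansion F A s) := by
  refine Submodule.span_le.2 ?_
  rintro _ ⟨w, hw, rfl⟩
  have hw : w.varMultiset = s.val := hw
  have hval : ∀ T : s.powerset, w.varMultiset.filter (· ∈ T.1) = T.1.val := by
    intro T
    rw [hw, ← Finset.filter_val, Finset.filter_mem_eq_inter,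
      Finset.inter_eq_right.2 (Finset.mem_powerset.1 T.2)]
  have hg : ∀ T : s.powerset, ∃ g : monomialSpan F A T.1.val, ∀ r : ℕ → A,
      evalWithOne F r (FreeMagma.restrict T.1 w) =
        (if T.1 = ∅ then 1 else 0) + (g.1 r : Unitization F A) := by
    intro T
    rcases FreeMagma.restrict_cases T.1 w with ⟨h1, h2⟩ | ⟨w', h1, h2⟩
    · refine ⟨0, fun r => ?_⟩
      rw [hval] at h2
      rw [h1, map_one, if_pos (Finset.val_eq_zero.1 h2)]
      simp
    · rw [hval] at h2
      refine ⟨⟨monomialFun A w', h2 ▸ monomialFun_mem_monomialSpan w'⟩, fun r => ?_⟩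
      rw [h1, evalWithOne_coe, if_neg, zero_add]
      intro h
      exact w'.varMultiset_ne_zero (by rw [h2, h]; rfl)
  choose g hg using hg
  refine ⟨(1, g), ?_⟩
  funext v
  rw [monomialFun_unitization w (by rw [hw]; exact s.nodup)]
  have hs : w.varMultiset.toFinset = s := by rw [hw]; exact Finset.val_toFinset s
  rw [hs, ← Finset.sum_coe_sort]
  simp only [unitExpansion, LinearMap.coe_mk, AddHom.coe_mk, hg, smul_add, Finset.sum_add_distrib]
  congr 1
  rw [Finset.sum_eq_single (⟨∅, Finset.empty_mem_powerset s⟩ : s.powerset)]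
  · simp
  · intro T _ hT
    rw [if_neg, smul_zero]
    exact fun h => hT (Subtype.ext h)
  · simp

/-- Adjoining a unit replaces the codimensions by (at most) their binomial transform. -/
theorem codim_unitization_le (n : ℕ) :
    codim F (Unitization F A) n ≤
      1 + ∑ T ∈ (Finset.range n).powerset, Module.finrank F (monomialSpan F A T.val) := by
  rw [codim_eq_finrank]
  refine (Submodule.finrank_mono (monomialSpan_unitization_le F A (Finset.range n))).trans ?_
  refine (LinearMap.finrank_range_le _).trans ?_
  rw [Module.finrank_prod, Module.finrank_self, Module.finrank_pi_fintype, Finset.sum_coe_sort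
    (Finset.range n).powerset fun T => Module.finrank F (monomialSpan F A T.val)]

theorem codim_le_codim_unitization (n : ℕ) :
    codim F A n ≤ codim F (Unitization F A) n := by
  rw [codim_eq_finrank, codim_eq_finrank]
  let Φ : ((ℕ → Unitization F A) → Unitization F A) →ₗ[F] ((ℕ → A) → A) :=
    { toFun := fun g r => (g fun i => (r i : Unitization F A)).snd
      map_add' := fun g h => by funext r; simp
      map_smul' := fun c g => by funext r; simp }
  have hΦ : monomialSpan F A (Multiset.range n) =
      (monomialSpan F (Unitization F A) (Multiset.range n)).map Φ := by
    rw [monomialSpan, monomialSpan, Submodule.map_span, Set.image_image]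
    congr 1
    refine Set.image_congr fun w _ => ?_
    funext r
    have h := evalWithOne_coe (F := F) r w
    rw [evalWithOne, WithOne.lift_coe] at h
    change _ = (monomialFun (Unitization F A) w fun i => (r i : Unitization F A)).snd
    rw [monomialFun, monomialFun, h, Unitization.snd_inr]
    rfl
  rw [hΦ]
  exact Submodule.finrank_map_le _ _

/-- Let `φ` be the generator `0`, and for `i = 1, …, k` replace `φ` by the commutator
`φ xᵢ - xᵢ φ` if `i ∈ S` and by `xᵢ φ` otherwise. -/
def commutatorFun (B : Type*) [NonUnitalNonAssocRing B] (S : Finset ℕ) :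
    ℕ → (ℕ → B) → B
  | 0 => fun v => v 0
  | k + 1 => fun v =>
    if k + 1 ∈ S then commutatorFun B S k v * v (k + 1) - v (k + 1) * commutatorFun B S k v
    else v (k + 1) * commutatorFun B S k v

end Unit

theorem mul_mem_monomialSpan {F B : Type*} [Field F] [NonUnitalNonAssocRing B] [Module F B]
    [IsScalarTower F B B] [SMulCommClass F B B] {s t : Multiset ℕ} {f g : (ℕ → B) → B}
    (hf : f ∈ monomialSpan F B s) (hg : g ∈ monomialSpan F B t) :
    f * g ∈ monomialSpan F B (s + t) := by
  unfold monomialSpan at hf hg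
  induction hf, hg using Submodule.span_induction₂ with
  | mem_mem f g hf hg =>
    obtain ⟨u, hu, rfl⟩ := hf
    obtain ⟨w, hw, rfl⟩ := hg
    have hu : u.varMultiset = s := hu
    have hw : w.varMultiset = t := hw
    refine Submodule.subset_span ⟨u * w, ?_, ?_⟩
    · change (u * w).varMultiset = _
      rw [FreeMagma.varMultiset_mul, hu, hw]
    · funext v; simp
  | zero_left g _ => rw [zero_mul]; exact Submodule.zero_mem _
  | zero_right f _ => rw [mul_zero]; exact Submodule.zero_mem _
  | add_left f g h _ _ _ h1 h2 => rw [add_mul]; exact Submodule.add_mem _ h1 h2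
  | add_right f g h _ _ _ h1 h2 => rw [mul_add]; exact Submodule.add_mem _ h1 h2
  | smul_left c f g _ _ h => rw [smul_mul_assoc]; exact Submodule.smul_mem _ c h
  | smul_right c f g _ _ h => rw [mul_smul_comm]; exact Submodule.smul_mem _ c h

theorem commutatorFun_mem {F B : Type*} [Field F] [NonUnitalNonAssocRing B] [Module F B]
    [IsScalarTower F B B] [SMulCommClass F B B] (S : Finset ℕ) (k : ℕ) :
    commutatorFun B S k ∈ monomialSpan F B (Multiset.range (k + 1)) := by
  have hgen : ∀ i, (fun v => v i) ∈ monomialSpan F B {i} := fun i =>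
    Submodule.subset_span ⟨.of i, rfl, rfl⟩
  induction k with
  | zero => exact hgen 0
  | succ k ih =>
    have h1 := mul_mem_monomialSpan ih (hgen (k + 1))
    have h2 := mul_mem_monomialSpan (hgen (k + 1)) ih
    rw [add_comm, Multiset.singleton_add, ← Multiset.range_succ] at h1
    rw [Multiset.singleton_add, ← Multiset.range_succ] at h2
    by_cases hk : k + 1 ∈ S
    · convert Submodule.sub_mem _ h1 h2 using 1
      funext v; simp [commutatorFun, hk]
    · convert h2 using 1
      funext v; simp [commutatorFun, hk]

/-- If right multiplication by `a` fixes a nonzero `z` and left multiplication by `a` kills it,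
then the codimensions of the algebra with adjoined unit are at least `2 ^ (n - 1)`: a product of
factors chosen as in `commutatorFun` detects which generators are mapped to `a` and which to `1`. -/
theorem two_pow_le_codim_unitization (F : Type*) [Field F] (A : Type*) [NonUnitalNonAssocRing A]
    [Module F A] [IsScalarTower F A A] [SMulCommClass F A A] (z a : A) (hz : z ≠ 0)
    (hza : z * a = z) (haz : a * z = 0) (k : ℕ) :
    2 ^ k ≤ codim F (Unitization F A) (k + 1) := by
  rw [codim_eq_finrank]
  let e : Finset ℕ → ℕ → Unitization F A := fun U i =>
    if i = 0 then (z : Unitization F A) else if i ∈ U then (a : Unitization F A) else 1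
  have hza' : (z : Unitization F A) * (a : Unitization F A) = z := by
    rw [← Unitization.inr_mul, hza]
  have haz' : (a : Unitization F A) * (z : Unitization F A) = 0 := by
    rw [← Unitization.inr_mul, haz, Unitization.inr_zero]
  have key : ∀ (S U : Finset ℕ) (j : ℕ),
      ((∀ i ∈ Finset.Icc 1 j, i ∈ S ↔ i ∈ U) → commutatorFun (Unitization F A) S j (e U) = z) ∧
      (¬ (∀ i ∈ Finset.Icc 1 j, i ∈ S ↔ i ∈ U) →
        commutatorFun (Unitization F A) S j (e U) = 0) := by
    intro S U j
    induction j with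
    | zero => simp [commutatorFun, e]
    | succ j ih =>
      have he : e U (j + 1) = if j + 1 ∈ U then (a : Unitization F A) else 1 := by simp [e]
      rw [← Finset.insert_Icc_right_eq_Icc_add_one (by omega), Finset.forall_mem_insert,
        commutatorFun]
      beta_reduce
      rw [he]
      refine ⟨fun h => ?_, fun h => ?_⟩
      · rw [ih.1 h.2]
        by_cases hU : j + 1 ∈ U
        · simp [hU, h.1.2 hU, hza', haz']
        · simp [hU, h.1]
      · by_cases h1 : ∀ i ∈ Finset.Icc 1 j, i ∈ S ↔ i ∈ U
        · rw [ih.1 h1]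
          by_cases hS : j + 1 ∈ S <;> by_cases hU : j + 1 ∈ U
          · exact absurd ⟨iff_of_true hS hU, h1⟩ h
          · simp [hS, hU]
          · simp [hS, hU, haz']
          · exact absurd ⟨iff_of_false hS hU, h1⟩ h
        · simp [ih.2 h1]
  have hcard : Fintype.card (Finset.Icc 1 k).powerset = 2 ^ k := by simp
  rw [← hcard]
  refine card_le_finrank_of_dual _
    (fun S : (Finset.Icc 1 k).powerset => commutatorFun (Unitization F A) S.1 k)
    (fun S => commutatorFun_mem S.1 k) (fun U => e U.1) LinearMap.id (z : Unitization F A)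
    (fun h => hz (Unitization.inr_injective (by simpa using h))) ?_
  rintro ⟨S, hS⟩ ⟨U, hU⟩
  rw [LinearMap.id_apply]
  have hiff : (∀ i ∈ Finset.Icc 1 k, i ∈ S ↔ i ∈ U) ↔ S = U := by
    rw [Finset.ext_iff]
    rw [Finset.mem_powerset] at hS hU
    refine ⟨fun h i => ?_, fun h i _ => h i⟩
    by_cases hi : i ∈ Finset.Icc 1 k
    · exact h i hi
    · exact ⟨fun h' => absurd (hS h') hi, fun h' => absurd (hU h') hi⟩
  by_cases hSU : S = U
  · rw [if_pos (Subtype.ext hSU), (key S U k).1 (hiff.2 hSU)]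
  · rw [if_neg fun h => hSU (congrArg Subtype.val h), (key S U k).2 fun h => hSU (hiff.1 h)]

/-! ### The algebra of a labelled path system -/

/-- A set of states, each with one predecessor; the arrow from the predecessor to the state
carries a letter from `ℕ`, or `none` if the arrow is deleted. -/
structure PathSystem (S : Type) where
  /-- the source of the arrow that ends in the given state -/
  pred : S → S
  /-- the letter on the arrow that ends in the given state -/
  label : S → Option ℕ

namespace PathSystem

variable {S : Type} (Q : PathSystem S) (F : Type u) [Field F]

/-- The underlying space of the algebra of a path system: coefficients at the letters, and
coefficients at the states. -/
def Alg (_Q : PathSystem S) (F : Type u) : Type u := (ℕ → F) × (S → F)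

variable {F} in
/-- The coefficient at a letter, which is `0` for the missing letter. -/
def coeff (y : ℕ → F) (o : Option ℕ) : F := o.elim 0 y

@[simp] theorem coeff_none (y : ℕ → F) : coeff y none = 0 := rfl

@[simp] theorem coeff_some (y : ℕ → F) (a : ℕ) : coeff y (some a) = y a := rfl

instance : AddCommGroup (Q.Alg F) := inferInstanceAs (AddCommGroup ((ℕ → F) × (S → F)))

instance : Module F (Q.Alg F) := inferInstanceAs (Module F ((ℕ → F) × (S → F)))

/-- The letters act on the states from the right by moving along the arrows that carry them; all
other products are zero. -/
instance : Mul (Q.Alg F) where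
  mul x y := (0, fun s => x.2 (Q.pred s) * coeff y.1 (Q.label s))

variable {F Q}

variable (F Q) in
/-- The coefficients at the letters. -/
def letters : Q.Alg F →ₗ[F] (ℕ → F) := LinearMap.fst F (ℕ → F) (S → F)

variable (F Q) in
/-- The coefficients at the states. -/
def states : Q.Alg F →ₗ[F] (S → F) := LinearMap.snd F (ℕ → F) (S → F)

theorem mul_fst (x y : Q.Alg F) : (x * y).1 = 0 := rfl

theorem mul_snd (x y : Q.Alg F) (s : S) :
    (x * y).2 s = x.2 (Q.pred s) * coeff y.1 (Q.label s) := rfl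

@[simp] theorem zero_fst : (0 : Q.Alg F).1 = 0 := rfl

@[simp] theorem zero_snd : (0 : Q.Alg F).2 = 0 := rfl

theorem coeff_add (y y' : ℕ → F) (o : Option ℕ) : coeff (y + y') o = coeff y o + coeff y' o := by
  cases o <;> simp

theorem coeff_smul (c : F) (y : ℕ → F) (o : Option ℕ) : coeff (c • y) o = c * coeff y o := by
  cases o <;> simp

theorem coeff_zero (o : Option ℕ) : coeff (0 : ℕ → F) o = 0 := by
  cases o <;> simp

instance : NonUnitalNonAssocRing (Q.Alg F) where
  left_distrib x y z := Prod.ext (add_zero _).symm <| funext fun s => by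
    change x.2 _ * coeff (y.1 + z.1) _ = x.2 _ * coeff y.1 _ + x.2 _ * coeff z.1 _
    rw [coeff_add, mul_add]
  right_distrib x y z := Prod.ext (add_zero _).symm <| funext fun s => by
    change (x.2 _ + y.2 _) * coeff z.1 _ = x.2 _ * coeff z.1 _ + y.2 _ * coeff z.1 _
    rw [add_mul]
  zero_mul x := Prod.ext rfl <| funext fun s => zero_mul _
  mul_zero x := Prod.ext rfl <| funext fun s => by
    change x.2 _ * coeff 0 _ = 0
    rw [coeff_zero, mul_zero]

instance : IsScalarTower F (Q.Alg F) (Q.Alg F) where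
  smul_assoc c _ _ := Prod.ext (smul_zero c).symm <| funext fun _ => mul_assoc c _ _

instance : SMulCommClass F (Q.Alg F) (Q.Alg F) where
  smul_comm c x y := Prod.ext (smul_zero c) <| funext fun s => by
    change c * (x.2 _ * coeff y.1 _) = x.2 _ * coeff (c • y.1) _
    rw [coeff_smul, mul_left_comm]

/-- Any sequence of generators is the sequence of a left-normed monomial, whose value at a state
is computed along the path that ends there. The factor `τ t` acts on the arrow that is `t` steps
before the end of the path. -/
theorem exists_monomial (m : ℕ) (i₀ : ℕ) (τ : ℕ → ℕ) : ∃ w : FreeMagma ℕ,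
    w.varMultiset = i₀ ::ₘ (Multiset.range m).map τ ∧
    ∀ (v : ℕ → Q.Alg F) (s : S), (monomialFun (Q.Alg F) w v).2 s = (v i₀).2 (Q.pred^[m] s) *
      ∏ t ∈ Finset.range m, coeff (v (τ t)).1 (Q.label (Q.pred^[t] s)) := by
  induction m generalizing τ with
  | zero => exact ⟨.of i₀, by simp, by simp⟩
  | succ m ih =>
    obtain ⟨w, hw, h⟩ := ih fun t => τ (t + 1)
    refine ⟨w * .of (τ 0), ?_, fun v s => ?_⟩
    · rw [FreeMagma.varMultiset_mul, hw, FreeMagma.varMultiset_of, Multiset.cons_add]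
      congr 1
      rw [← Multiset.coe_range, ← Multiset.coe_range, Multiset.map_coe, Multiset.map_coe,
        List.range_succ_eq_map, List.map_cons, List.map_map, ← Multiset.cons_coe, add_comm,
        Multiset.singleton_add]
      rfl
    · rw [monomialFun_mul, mul_snd, h, Finset.prod_range_succ', mul_assoc]
      rfl

/-- A monomial that is not left-normed vanishes on the algebra of a path system; the others are
computed along paths. -/
theorem monomialFun_cases (w : FreeMagma ℕ) : (∀ v : ℕ → Q.Alg F, monomialFun (Q.Alg F) w v = 0) ∨
    ∃ (m i₀ : ℕ) (τ : ℕ → ℕ), w.varMultiset = i₀ ::ₘ (Multiset.range m).map τ ∧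
    (m ≠ 0 → ∀ v : ℕ → Q.Alg F, (monomialFun (Q.Alg F) w v).1 = 0) ∧
    ∀ (v : ℕ → Q.Alg F) (s : S), (monomialFun (Q.Alg F) w v).2 s = (v i₀).2 (Q.pred^[m] s) *
      ∏ t ∈ Finset.range m, coeff (v (τ t)).1 (Q.label (Q.pred^[t] s)) := by
  induction w using FreeMagma.recOnMul with
  | ih1 x => exact Or.inr ⟨0, x, id, by simp, by simp, by simp⟩
  | ih2 u w hu _ =>
    cases w with
    | mul w w' =>
      left
      intro v
      rw [monomialFun_mul]
      refine Prod.ext rfl (funext fun s => ?_)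
      rw [mul_snd]
      change _ * coeff (monomialFun (Q.Alg F) (w * w') v).1 _ = 0
      rw [monomialFun_mul, mul_fst, coeff_zero, mul_zero]
    | of i =>
      rcases hu with hu | ⟨m, i₀, τ, hc, -, h⟩
      · left
        intro v
        rw [monomialFun_mul, hu, zero_mul]
      · refine Or.inr ⟨m + 1, i₀, fun t => t.casesOn i τ, ?_, fun _ v => ?_, fun v s => ?_⟩
        · change u.varMultiset + {i} = _
          rw [hc, Multiset.cons_add]
          congr 1
          rw [← Multiset.coe_range, ← Multiset.coe_range, Multiset.map_coe, Multiset.map_coe,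
            List.range_succ_eq_map, List.map_cons, List.map_map, ← Multiset.cons_coe, add_comm,
            Multiset.singleton_add]
          rfl
        · rw [monomialFun_mul, mul_fst]
        · rw [monomialFun_mul, mul_snd, h, Finset.prod_range_succ', mul_assoc]
          rfl

/-! ### Upper bound for the codimensions -/

/-- The positions, counted from the end, of the letters different from `0` on the path of
length `m` that ends in the state `s`. -/
def pattern (Q : PathSystem S) (m : ℕ) (s : S) : Finset ℕ :=
  (Finset.range m).filter fun t => Q.label (Q.pred^[t] s) ≠ some 0

/-- No arrow is deleted from the path of length `m` that ends in the state `s`. -/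
def Alive (Q : PathSystem S) (m : ℕ) (s : S) : Prop :=
  ∀ t < m, Q.label (Q.pred^[t] s) ≠ none

open Classical in
/-- The part of a left-normed monomial with content `s` that lives in the states with pattern `p`.
It only depends on the first generator `i` and on the generators `f` at the positions in `p`,
since all others are evaluated at the letter `0`. -/
noncomputable def patternFun (Q : PathSystem S) (F : Type u) [Field F] (s : Finset ℕ) (m : ℕ)
    (p : Finset ℕ) (i : s) (f : p → s) (v : ℕ → Q.Alg F) : Q.Alg F :=
  (0, fun x => if Q.Alive m x ∧ Q.pattern m x = p then
    (v i).2 (Q.pred^[m] x) * (∏ t : p, coeff (v (f t)).1 (Q.label (Q.pred^[(t : ℕ)] x))) *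
      ∏ j ∈ s \ insert i.1 (Finset.univ.image fun t => (f t).1), (v j).1 0
    else 0)

/-- The value of a monomial at a state is the contribution of the pattern of this state, so the
monomial is a sum of one function per pattern. -/
theorem monomialFun_mem_span_patternFun {s : Finset ℕ} {m : ℕ} (hs : s.card = m + 1) (hm : m ≠ 0)
    {P : Finset (Finset ℕ)} (hP : ∀ x, Q.Alive m x → Q.pattern m x ∈ P) {w : FreeMagma ℕ}
    (hw : w.varMultiset = s.val) :
    monomialFun (Q.Alg F) w ∈ Submodule.span F (Set.range
      fun k : (p : P) × s × (p.1 → s) => patternFun Q F s m k.1.1 k.2.1 k.2.2) := by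
  classical
  rcases monomialFun_cases (Q := Q) (F := F) w with h0 | ⟨m', i₀, τ, hc, h1, h2⟩
  · rw [show monomialFun (Q.Alg F) w = 0 from funext h0]
    exact Submodule.zero_mem _
  obtain rfl : m = m' := by
    have := congrArg Multiset.card (hw.symm.trans hc)
    simp only [Finset.card_val, Multiset.card_cons, Multiset.card_map, Multiset.card_range] at this
    omega
  have hc' := hw.symm.trans hc
  have hnd : (i₀ ::ₘ (Multiset.range m).map τ).Nodup := hc' ▸ s.nodup
  rw [Multiset.nodup_cons] at hnd
  have hinj : Set.InjOn τ (Finset.range m) := by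
    intro a ha b hb hab
    exact Multiset.inj_on_of_nodup_map hnd.2 a (by simpa using ha) b (by simpa using hb) hab
  have hi₀ : ∀ t < m, τ t ≠ i₀ := fun t ht h =>
    hnd.1 (Multiset.mem_map.2 ⟨t, by simpa using ht, h⟩)
  have hmem : ∀ j, j ∈ s ↔ j = i₀ ∨ ∃ t < m, τ t = j := by
    intro j
    rw [← Finset.mem_val, hc']
    simp
  have hi₀s : i₀ ∈ s := (hmem _).2 (Or.inl rfl)
  let f : (p : P) → p.1 → s := fun p t => if h : τ t ∈ s then ⟨τ t, h⟩ else ⟨i₀, hi₀s⟩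
  have hsum : monomialFun (Q.Alg F) w = ∑ p : P, patternFun Q F s m p.1 ⟨i₀, hi₀s⟩ (f p) := by
    funext v
    rw [Finset.sum_apply]
    refine Prod.ext ?_ (funext fun x => ?_)
    · refine (h1 hm v).trans (Eq.symm ?_)
      exact (map_sum (letters Q F) _ _).trans (Finset.sum_eq_zero fun _ _ => rfl)
    · refine (h2 v x).trans (Eq.symm ?_)
      refine (congrFun (map_sum (states Q F) _ _) x).trans (Eq.symm ?_)
      rw [Finset.sum_apply]
      change _ = ∑ p : P, (patternFun Q F s m p.1 ⟨i₀, hi₀s⟩ (f p) v).2 x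
      by_cases hx : Q.Alive m x
      · rw [Finset.sum_eq_single (⟨Q.pattern m x, hP x hx⟩ : P)]
        · have hf : ∀ t : Q.pattern m x, (f ⟨Q.pattern m x, hP x hx⟩ t).1 = τ t := by
            intro t
            have ht : (t : ℕ) < m := by simpa using (Finset.mem_filter.1 t.2).1
            simp only [f]
            rw [dif_pos ((hmem _).2 (Or.inr ⟨t, ht, rfl⟩))]
          simp only [patternFun]
          rw [if_pos ⟨hx, trivial⟩, mul_assoc]
          congr 1
          rw [← Finset.prod_filter_mul_prod_filter_not (Finset.range m)
            (fun t => Q.label (Q.pred^[t] x) ≠ some 0)]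
          congr 1
          · simp only [hf]
            exact (Finset.prod_coe_sort (Q.pattern m x)
              (fun t => coeff (v (τ t)).1 (Q.label (Q.pred^[t] x)))).symm
          · simp only [hf]
            have himg : s \ insert i₀ (Finset.univ.image fun t : Q.pattern m x => τ t) =
                ((Finset.range m).filter fun t => ¬ Q.label (Q.pred^[t] x) ≠ some 0).image τ := by
              ext j
              simp only [Finset.mem_sdiff, Finset.mem_insert, Finset.mem_image, Finset.mem_univ,
                true_and, Finset.mem_filter, Finset.mem_range, hmem, not_or]
              constructor
              · rintro ⟨rfl | ⟨t, ht, rfl⟩, h, h'⟩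
                · exact absurd rfl h
                · exact ⟨t, ⟨ht, fun h'' =>
                    h' ⟨⟨t, Finset.mem_filter.2 ⟨Finset.mem_range.2 ht, h''⟩⟩, rfl⟩⟩, rfl⟩
              · rintro ⟨t, ⟨ht, h'⟩, rfl⟩
                refine ⟨Or.inr ⟨t, ht, rfl⟩, hi₀ t ht, ?_⟩
                rintro ⟨⟨t', h''⟩, heq⟩
                obtain ⟨ht', h''⟩ := Finset.mem_filter.1 h''
                rw [show t' = t from hinj (by simpa using ht') (by simpa using ht) heq] at h''
                exact h' h''
            rw [himg, Finset.prod_image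
              (hinj.mono (by exact_mod_cast Finset.filter_subset _ _))]
            refine Finset.prod_congr rfl fun t ht => ?_
            rw [not_not.1 (Finset.mem_filter.1 ht).2, coeff_some]
        · intro p _ hp
          simp only [patternFun]
          rw [if_neg]
          rintro ⟨-, h⟩
          exact hp (Subtype.ext h.symm)
        · simp
      · rw [Finset.sum_eq_zero]
        · simp only [Alive, not_forall, not_not] at hx
          obtain ⟨t, ht, h⟩ := hx
          rw [Finset.prod_eq_zero (Finset.mem_range.2 ht) (by rw [h, coeff_none]), mul_zero]
        · intro p _
          simp only [patternFun]
          rw [if_neg fun h => hx h.1]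
  rw [hsum]
  exact Submodule.sum_mem _ fun p _ => Submodule.subset_span ⟨⟨p, ⟨i₀, hi₀s⟩, f p⟩, rfl⟩

theorem finrank_monomialSpan_le {s : Finset ℕ} {m : ℕ} (hs : s.card = m + 1) (hm : m ≠ 0)
    {P : Finset (Finset ℕ)} (hP : ∀ x, Q.Alive m x → Q.pattern m x ∈ P) :
    Module.finrank F (monomialSpan F (Q.Alg F) s.val) ≤
      ∑ p ∈ P, s.card * s.card ^ p.card := by
  classical
  have hle : monomialSpan F (Q.Alg F) s.val ≤ Submodule.span F (Set.range
      fun k : (p : P) × s × (p.1 → s) => patternFun Q F s m k.1.1 k.2.1 k.2.2) := by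
    refine Submodule.span_le.2 ?_
    rintro _ ⟨w, hw, rfl⟩
    exact monomialFun_mem_span_patternFun hs hm hP hw
  have := FiniteDimensional.span_of_finite F (Set.finite_range
      fun k : (p : P) × s × (p.1 → s) => patternFun Q F s m k.1.1 k.2.1 k.2.2)
  refine (Submodule.finrank_mono hle).trans ((finrank_range_le_card _).trans ?_)
  rw [Fintype.card_sigma, ← Finset.sum_coe_sort P]
  simp

/-! ### Lower bound for the codimensions -/

/-- If `q` of the letters on a path of length `N` occur only once, then the monomials that differ
in the generators at the positions `pos` of these letters are linearly independent. -/
theorem descFactorial_le_codim (x : S) {N q : ℕ} (l : Fin N → ℕ)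
    (hl : ∀ t : Fin N, Q.label (Q.pred^[(t : ℕ)] x) = some (l t)) (pos : Fin q ↪ Fin N)
    (hpos : ∀ k t, l t = l (pos k) → t = pos k) :
    N.descFactorial q ≤ codim F (Q.Alg F) (N + 1) := by
  classical
  have hext : ∀ e : Fin q ↪ Fin N, ∃ σ : Equiv.Perm (Fin N), ∀ k, σ (pos k) = e k := by
    intro e
    obtain ⟨σ, hσ⟩ := (MulAction.isMultiplyPretransitive_iff (G := Equiv.Perm (Fin N))).1
      (Equiv.Perm.isMultiplyPretransitive (Fin N) q) pos e
    exact ⟨σ, fun k => DFunLike.congr_fun hσ k⟩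
  choose σ hσ using hext
  let τ : (Fin q ↪ Fin N) → ℕ → ℕ := fun e t => if h : t < N then (σ e ⟨t, h⟩ : ℕ) + 1 else 0
  choose w hw hval using fun e => exists_monomial (Q := Q) (F := F) N 0 (τ e)
  have hcontent : ∀ e, (w e).varMultiset = Multiset.range (N + 1) := by
    intro e
    have h1 : Multiset.range N =
        Multiset.map (fun t : Fin N => (t : ℕ)) (Finset.univ : Finset (Fin N)).val := by
      have := congrArg Finset.val (Fin.map_valEmbedding_univ (n := N))
      rw [Nat.Iio_eq_range] at this
      exact this.symm
    have h2 : Multiset.map (σ e) (Finset.univ : Finset (Fin N)).val = Finset.univ.val :=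
      congrArg Finset.val (Finset.map_univ_equiv (σ e))
    have h3 : (Multiset.range N).map (τ e) = (Multiset.range N).map (· + 1) := by
      conv_rhs => rw [h1, ← h2]
      rw [h1, Multiset.map_map, Multiset.map_map, Multiset.map_map]
      refine Multiset.map_congr rfl fun t _ => ?_
      simp [τ]
    rw [hw, h3, ← Multiset.coe_range, ← Multiset.coe_range, Multiset.map_coe,
      List.range_succ_eq_map, ← Multiset.cons_coe]
  -- The generator `σ e t + 1` is sent to the letter at position `t`, so that only the monomial
  -- of `e` (among those of all embeddings) spells the word read along the path.
  let y : (Fin q ↪ Fin N) → ℕ → ℕ → F := fun e i =>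
    if h : i - 1 < N then Pi.single (l ((σ e).symm ⟨i - 1, h⟩)) 1 else 0
  let pt : (Fin q ↪ Fin N) → ℕ → Q.Alg F := fun e i => (y e i, fun _ => 1)
  have hcard : Fintype.card (Fin q ↪ Fin N) = N.descFactorial q := by
    rw [Fintype.card_embedding_eq, Fintype.card_fin, Fintype.card_fin]
  rw [codim_eq_finrank, ← hcard]
  refine card_le_finrank_of_dual _ (fun e => monomialFun (Q.Alg F) (w e))
    (fun e => hcontent e ▸ monomialFun_mem_monomialSpan (w e)) pt
    ((LinearMap.proj x).comp (states Q F)) 1 one_ne_zero ?_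
  intro e e'
  change (monomialFun (Q.Alg F) (w e) (pt e')).2 x = _
  rw [hval, show (pt e' 0).2 = fun _ => 1 from rfl, one_mul, Finset.prod_range]
  have hfac : ∀ t : Fin N, coeff (pt e' (τ e t)).1 (Q.label (Q.pred^[(t : ℕ)] x)) =
      if l t = l ((σ e').symm (σ e t)) then 1 else 0 := by
    intro t
    have h1 : τ e t = (σ e t : ℕ) + 1 := by simp [τ]
    rw [hl, coeff_some, h1]
    simp [pt, y, Pi.single_apply]
  simp only [hfac]
  by_cases he : e = e'
  · subst he
    simp
  · rw [if_neg he]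
    obtain ⟨k, hk⟩ : ∃ k, e k ≠ e' k := by
      by_contra! h
      exact he (DFunLike.ext _ _ h)
    refine Finset.prod_eq_zero (Finset.mem_univ (pos k)) (if_neg fun h => hk ?_)
    have := hpos k _ h.symm
    rw [Equiv.symm_apply_eq, hσ, hσ] at this
    exact this

end PathSystem

theorem FreeMagma.eq_of_of_varMultiset_eq_singleton {X : Type*} {w : FreeMagma X} {i : X}
    (h : w.varMultiset = {i}) : w = .of i := by
  cases w with
  | of x => rw [Multiset.singleton_inj.1 h]
  | mul u v =>
    have h1 := congrArg Multiset.card (show u.varMultiset + v.varMultiset = {i} from h)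
    have h2 := Multiset.card_pos.2 u.varMultiset_ne_zero
    have h3 := Multiset.card_pos.2 v.varMultiset_ne_zero
    rw [Multiset.card_add, Multiset.card_singleton] at h1
    omega

theorem finrank_monomialSpan_singleton_le {F A : Type*} [Field F] [NonUnitalNonAssocRing A]
    [Module F A] (i : ℕ) : Module.finrank F (monomialSpan F A {i}) ≤ 1 := by
  have : {w : FreeMagma ℕ | w.varMultiset = {i}} ⊆ {.of i} := fun w hw =>
    FreeMagma.eq_of_of_varMultiset_eq_singleton hw
  have hle : monomialSpan F A {i} ≤ Submodule.span F {monomialFun A (.of i)} := by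
    refine Submodule.span_mono ?_
    rintro _ ⟨w, hw, rfl⟩
    rw [this hw]; rfl
  exact (Submodule.finrank_mono hle).trans ((finrank_span_le_card _).trans (by simp))

theorem finrank_monomialSpan_zero {F A : Type*} [Field F] [NonUnitalNonAssocRing A]
    [Module F A] : Module.finrank F (monomialSpan F A 0) = 0 := by
  have : {w : FreeMagma ℕ | w.varMultiset = 0} = ∅ :=
    Set.eq_empty_of_forall_notMem fun w hw => w.varMultiset_ne_zero hw
  rw [monomialSpan, this, Set.image_empty, Submodule.span_empty, finrank_bot]

/-! ### The block system -/

/-- The members of an arithmetic progression of difference `d` below `m`. -/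
def progression (m d r : ℕ) : Finset ℕ := (Finset.range m).filter fun t => t % d = r

/-- All progressions below `m`. -/
def progressions (m : ℕ) : Finset (Finset ℕ) :=
  (Finset.range (m + 1) ×ˢ Finset.range (m + 1)).image fun p => progression m (p.1 + 1) p.2

theorem card_progressions_le (m : ℕ) : (progressions m).card ≤ (m + 1) ^ 2 := by
  refine Finset.card_image_le.trans ?_
  rw [Finset.card_product, Finset.card_range, sq]

theorem progression_mem (m d r : ℕ) (hd : 0 < d) (hr : r < d) :
    progression m d r ∈ progressions m := by
  rw [progressions, Finset.mem_image]
  rcases le_or_gt d (m + 1) with h | h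
  · refine ⟨(d - 1, r), by simp; omega, ?_⟩
    rw [Nat.sub_add_cancel hd]
  -- A progression of difference larger than `m` has at most one member below `m`.
  · refine ⟨(m, min r m), by simp, ?_⟩
    refine Finset.filter_congr fun t ht => ?_
    rw [Finset.mem_range] at ht
    rw [Nat.mod_eq_of_lt (by omega), Nat.mod_eq_of_lt (by omega)]
    omega

theorem card_progression_le (m d r : ℕ) : (progression m d r).card ≤ m / d + 1 := by
  rw [← Finset.card_range (m / d + 1)]
  refine Finset.card_le_card_of_injOn (fun t => t / d) ?_ ?_
  · intro t ht
    have := (Finset.mem_filter.1 ht).1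
    rw [Finset.mem_range] at this
    simpa [Nat.lt_succ_iff] using Nat.div_le_div_right this.le
  · intro t ht t' ht' h
    have h1 := (Finset.mem_filter.1 ht).2
    have h2 := (Finset.mem_filter.1 ht').2
    rw [← Nat.div_add_mod t d, ← Nat.div_add_mod t' d, h1, h2]
    simp only at h
    rw [h]

/-- A loop with the letter `0`, and for each `g` a path `(g, 0), …, (g, N g)` whose arrows carry
the letter `0`, except that every `M g`-th arrow carries a new letter: the words
`0 … 0 1 0 … 0 2 0 … 0 3 …`. The arrows into the other states `(g, j)`, and into `(g, 0)`, are
deleted. -/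
def blockSystem (M N : ℕ → ℕ) : PathSystem (Option (ℕ × ℕ)) where
  pred s := s.map fun p => (p.1, p.2 - 1)
  label
    | none => some 0
    | some (g, j) => if 1 ≤ j ∧ j ≤ N g then some (if M g ∣ j then j / M g else 0) else none

section BlockSystem

variable {M N : ℕ → ℕ}

theorem blockSystem_iterate_none (t : ℕ) : (blockSystem M N).pred^[t] none = none :=
  Function.iterate_fixed rfl t

theorem blockSystem_iterate_some (t g j : ℕ) :
    (blockSystem M N).pred^[t] (some (g, j)) = some (g, j - t) := by
  induction t with
  | zero => rfl
  | succ t ih => rw [Function.iterate_succ_apply', ih, Nat.sub_succ]; rfl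

theorem blockSystem_label_some (g j : ℕ) : (blockSystem M N).label (some (g, j)) =
    if 1 ≤ j ∧ j ≤ N g then some (if M g ∣ j then j / M g else 0) else none := rfl

theorem blockSystem_alive {m g j : ℕ} (hm : m ≠ 0)
    (h : (blockSystem M N).Alive m (some (g, j))) : m ≤ j ∧ j ≤ N g := by
  have h0 := h 0 (by omega)
  have h1 := h (m - 1) (by omega)
  rw [blockSystem_iterate_some, blockSystem_label_some] at h0 h1
  have h0' : 1 ≤ j - 0 ∧ j - 0 ≤ N g := by
    by_contra hc; rw [if_neg hc] at h0; exact h0 rfl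
  have h1' : 1 ≤ j - (m - 1) ∧ j - (m - 1) ≤ N g := by
    by_contra hc; rw [if_neg hc] at h1; exact h1 rfl
  omega

theorem blockSystem_pattern_none (m : ℕ) : (blockSystem M N).pattern m none = ∅ := by
  rw [PathSystem.pattern, Finset.filter_eq_empty_iff]
  intro t _
  rw [blockSystem_iterate_none]
  exact fun h => h rfl

theorem blockSystem_pattern_some (hM : ∀ g, 0 < M g) {m g j : ℕ} (h1 : m ≤ j) (h2 : j ≤ N g) :
    (blockSystem M N).pattern m (some (g, j)) = progression m (M g) (j % M g) := by
  refine Finset.filter_congr fun t ht => ?_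
  rw [Finset.mem_range] at ht
  rw [blockSystem_iterate_some, blockSystem_label_some, if_pos (by omega)]
  have h3 : M g ∣ j - t ↔ t % M g = j % M g := (Nat.modEq_iff_dvd' (by omega)).symm
  rw [← h3, ne_eq, Option.some_inj]
  by_cases hd : M g ∣ j - t
  · rw [if_pos hd]
    have := Nat.div_pos (Nat.le_of_dvd (by omega) hd) (hM g)
    simp only [hd, iff_true]; omega
  · simp [hd]

/-- The codimensions are at most `n ^ 4` times the largest number of choices of the generators at
the distinguished positions on a path of length `n - 1`, apart from the first such position. -/
theorem blockSystem_finrank_le (F : Type u) [Field F] (hM : ∀ g, 0 < M g) (s : Finset ℕ) {B : ℝ}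
    (hB : 1 ≤ B) (h : ∀ g, s.card ≤ N g + 1 → (s.card : ℝ) ^ ((s.card - 1) / M g) ≤ B) :
    (Module.finrank F (monomialSpan F ((blockSystem M N).Alg F) s.val) : ℝ) ≤
      (s.card : ℝ) ^ 4 * B := by
  classical
  obtain hs | hs | ⟨m, hm, hs⟩ : s.card = 0 ∨ s.card = 1 ∨ ∃ m, m ≠ 0 ∧ s.card = m + 1 := by
    rcases hc : s.card with _ | _ | m
    · simp
    · simp
    · exact Or.inr (Or.inr ⟨m + 1, by omega, rfl⟩)
  · rw [Finset.card_eq_zero] at hs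
    subst hs
    rw [Finset.empty_val, finrank_monomialSpan_zero]
    simp
  · rw [hs]
    obtain ⟨i, rfl⟩ := Finset.card_eq_one.1 hs
    have : (Module.finrank F (monomialSpan F ((blockSystem M N).Alg F) {i}) : ℝ) ≤ 1 := by
      exact_mod_cast finrank_monomialSpan_singleton_le i
    simpa using this.trans hB
  · rw [hs] at h ⊢
    let P := (progressions m).filter fun p => ((m + 1 : ℕ) : ℝ) ^ p.card ≤ (m + 1 : ℕ) * B
    have hn : (1 : ℝ) ≤ (m + 1 : ℕ) := by norm_cast; omega
    have hP : ∀ x, (blockSystem M N).Alive m x → (blockSystem M N).pattern m x ∈ P := by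
      intro x hx
      rcases x with _ | ⟨g, j⟩
      · rw [blockSystem_pattern_none, Finset.mem_filter]
        refine ⟨?_, by simpa using one_le_mul_of_one_le_of_one_le hn hB⟩
        convert progression_mem m (m + 1) m (by omega) (by omega)
        refine (Finset.filter_eq_empty_iff.2 fun t ht => ?_).symm
        rw [Finset.mem_range] at ht
        rw [Nat.mod_eq_of_lt (by omega)]; omega
      · obtain ⟨h1, h2⟩ := blockSystem_alive hm hx
        rw [blockSystem_pattern_some hM h1 h2, Finset.mem_filter]
        refine ⟨progression_mem _ _ _ (hM g) (Nat.mod_lt _ (hM g)), ?_⟩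
        refine (pow_le_pow_right₀ hn (card_progression_le _ _ _)).trans ?_
        rw [pow_succ, mul_comm]
        exact mul_le_mul_of_nonneg_left (h g (by omega)) (by positivity)
    have h1 := PathSystem.finrank_monomialSpan_le (F := F) hs hm hP
    rw [hs] at h1
    have h2 : (P.card : ℝ) ≤ ((m + 1 : ℕ) : ℝ) ^ 2 := by
      exact_mod_cast (Finset.card_filter_le _ _).trans (card_progressions_le m)
    calc _ ≤ ((∑ p ∈ P, (m + 1) * (m + 1) ^ p.card : ℕ) : ℝ) := by exact_mod_cast h1
      _ = ∑ p ∈ P, ((m + 1 : ℕ) : ℝ) * ((m + 1 : ℕ) : ℝ) ^ p.card := by push_cast; rfl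
      _ ≤ ∑ p ∈ P, ((m + 1 : ℕ) : ℝ) * ((m + 1 : ℕ) * B) := by
        refine Finset.sum_le_sum fun p hp => ?_
        exact mul_le_mul_of_nonneg_left (Finset.mem_filter.1 hp).2 (by positivity)
      _ = P.card * (((m + 1 : ℕ) : ℝ) ^ 2 * B) := by
        rw [Finset.sum_const, nsmul_eq_mul]; ring
      _ ≤ ((m + 1 : ℕ) : ℝ) ^ 2 * (((m + 1 : ℕ) : ℝ) ^ 2 * B) := by
        exact mul_le_mul_of_nonneg_right h2 (by positivity)
      _ = _ := by ring

theorem blockSystem_one_le_codim (F : Type u) [Field F] (n : ℕ) :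
    1 ≤ codim F ((blockSystem M N).Alg F) (n + 1) := by
  have := PathSystem.descFactorial_le_codim (F := F) (Q := blockSystem M N) none (N := n) (q := 0)
    (fun _ => 0) (fun t => by rw [blockSystem_iterate_none]; rfl)
    ⟨Fin.elim0, fun k => k.elim0⟩ (fun k => k.elim0)
  simpa using this

theorem blockSystem_descFactorial_le_codim (F : Type u) [Field F] (g q : ℕ) (hM : 0 < M g)
    (hq : N g = q * M g) :
    (N g).descFactorial q ≤ codim F ((blockSystem M N).Alg F) (N g + 1) := by
  have hlt : ∀ k : Fin q, (k : ℕ) * M g < N g := fun k => by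
    rw [hq]; exact Nat.mul_lt_mul_of_pos_right k.2 hM
  refine PathSystem.descFactorial_le_codim (F := F) (Q := blockSystem M N) (some (g, N g))
    (fun t => if M g ∣ N g - t then (N g - t) / M g else 0) (fun t => ?_)
    ⟨fun k => ⟨k * M g, hlt k⟩, fun k k' h => ?_⟩ (fun k t h => ?_)
  · rw [blockSystem_iterate_some, blockSystem_label_some, if_pos (by omega)]
  · exact Fin.ext (Nat.eq_of_mul_eq_mul_right hM (Fin.mk.inj h))
  · have h1 : N g - k * M g = (q - k) * M g := by rw [hq, Nat.sub_mul]
    have h2 : M g ∣ N g - k * M g := h1 ▸ Dvd.intro_left _ rfl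
    change (if M g ∣ N g - t then (N g - t) / M g else 0) =
      if M g ∣ N g - k * M g then (N g - k * M g) / M g else 0 at h
    rw [if_pos h2, h1, Nat.mul_div_cancel _ hM] at h
    have hk := k.2
    by_cases hd : M g ∣ N g - t
    · rw [if_pos hd] at h
      have h3 := Nat.div_mul_cancel hd
      rw [h, ← h1] at h3
      have := hlt k
      have := t.2
      refine Fin.ext ?_
      change (t : ℕ) = k * M g
      omega
    · rw [if_neg hd] at h
      omega

theorem blockSystem_two_pow_le_codim_unitization (F : Type u) [Field F] (n : ℕ) :
    2 ^ n ≤ codim F (Unitization F ((blockSystem M N).Alg F)) (n + 1) := by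
  classical
  refine two_pow_le_codim_unitization F ((blockSystem M N).Alg F)
    ((0, Pi.single none 1) : (ℕ → F) × (Option (ℕ × ℕ) → F))
    ((Pi.single 0 1, 0) : (ℕ → F) × (Option (ℕ × ℕ) → F)) ?_ ?_ ?_ n
  · intro h
    have := congrFun (congrArg Prod.snd h) none
    simp at this
  · refine Prod.ext rfl (funext fun s => ?_)
    rcases s with _ | ⟨g, j⟩
    · change (Pi.single none 1 : Option (ℕ × ℕ) → F) none *
        (Pi.single 0 1 : ℕ → F) 0 = (Pi.single none 1 : Option (ℕ × ℕ) → F) none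
      simp
    · change (Pi.single none 1 : Option (ℕ × ℕ) → F) (some (g, j - 1)) * _ =
        (Pi.single none 1 : Option (ℕ × ℕ) → F) (some (g, j))
      simp
  · exact Prod.ext rfl (funext fun s => zero_mul _)

end BlockSystem

/-! ### Exponents and exponential bounds -/

section Exponents

variable {F : Type*} [Field F] {A : Type*} [NonUnitalNonAssocRing A] [Module F A]
  [IsScalarTower F A A] [SMulCommClass F A A]

theorem codimRoot_nonneg (n : ℕ) : 0 ≤ codimRoot F A n := Real.rpow_nonneg (Nat.cast_nonneg _) _

theorem codimRoot_le {γ : ℝ} (hγ : 0 ≤ γ) {n : ℕ} (hn : n ≠ 0) (h : (codim F A n : ℝ) ≤ γ ^ n) :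
    codimRoot F A n ≤ γ := by
  rw [codimRoot, one_div]
  calc _ ≤ (γ ^ n) ^ (n : ℝ)⁻¹ := Real.rpow_le_rpow (Nat.cast_nonneg _) h (by positivity)
    _ = γ := Real.pow_rpow_inv_natCast hγ hn

theorem le_codimRoot {γ : ℝ} (hγ : 0 ≤ γ) {n : ℕ} (hn : n ≠ 0) (h : γ ^ n ≤ (codim F A n : ℝ)) :
    γ ≤ codimRoot F A n := by
  rw [codimRoot, one_div]
  calc γ = (γ ^ n) ^ (n : ℝ)⁻¹ := (Real.pow_rpow_inv_natCast hγ hn).symm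
    _ ≤ _ := Real.rpow_le_rpow (by positivity) h (by positivity)

theorem isBoundedUnder_ge_codimRoot : IsBoundedUnder (· ≥ ·) atTop (codimRoot F A) :=
  isBoundedUnder_of ⟨0, codimRoot_nonneg⟩

theorem isBoundedUnder_le_codimRoot {γ : ℝ} (hγ : 0 ≤ γ)
    (h : ∀ᶠ n in atTop, (codim F A n : ℝ) ≤ γ ^ n) :
    IsBoundedUnder (· ≤ ·) atTop (codimRoot F A) := by
  refine isBoundedUnder_of_eventually_le (a := γ) ?_
  filter_upwards [h, eventually_ne_atTop 0] with n h1 h2 using codimRoot_le hγ h2 h1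

theorem codimExpBounded_of_eventually {γ : ℝ} (hγ : 1 ≤ γ)
    (h : ∀ᶠ n in atTop, (codim F A n : ℝ) ≤ γ ^ n) : CodimExpBounded F A := by
  obtain ⟨n₀, h⟩ := eventually_atTop.1 h
  have h0 : (0 : ℝ) ≤ ∑ k ∈ Finset.range n₀, (codim F A k : ℝ) :=
    Finset.sum_nonneg fun _ _ => Nat.cast_nonneg _
  refine ⟨1 + ∑ k ∈ Finset.range n₀, (codim F A k : ℝ), γ, fun n => ?_⟩
  have h1 : 1 ≤ γ ^ n := one_le_pow₀ hγ
  rcases le_or_gt n₀ n with hn | hn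
  · nlinarith [h n hn, mul_nonneg h0 (zero_le_one.trans h1)]
  · have h2 : (codim F A n : ℝ) ≤ ∑ k ∈ Finset.range n₀, (codim F A k : ℝ) :=
      Finset.single_le_sum (f := fun k => (codim F A k : ℝ)) (fun _ _ => Nat.cast_nonneg _)
        (Finset.mem_range.2 hn)
    nlinarith [mul_nonneg h0 (sub_nonneg.2 h1)]

theorem upperPIExp_le {L : ℝ} (hL : 0 ≤ L)
    (h : ∀ γ > L, ∀ᶠ n in atTop, (codim F A n : ℝ) ≤ γ ^ n) : upperPIExp F A ≤ L := by
  refine le_of_forall_gt_imp_ge_of_dense fun γ hγ => ?_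
  refine limsup_le_of_le isBoundedUnder_ge_codimRoot.isCoboundedUnder_le ?_
  filter_upwards [h γ hγ, eventually_ne_atTop 0] with n h1 h2
  exact codimRoot_le (hL.trans hγ.le) h2 h1

theorem le_upperPIExp {L a : ℝ} (ha : 0 ≤ a) (haL : a < L)
    (hb : IsBoundedUnder (· ≤ ·) atTop (codimRoot F A))
    (h : ∀ γ, a < γ → γ < L → ∃ᶠ n in atTop, γ ^ n ≤ (codim F A n : ℝ)) :
    L ≤ upperPIExp F A := by
  refine le_of_forall_lt_imp_le_of_dense fun δ hδ => ?_
  obtain ⟨γ, h0, h2⟩ := exists_between (max_lt hδ haL)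
  refine (le_max_left δ a).trans (h0.le.trans ?_)
  have h1 := (le_max_right δ a).trans_lt h0
  refine le_limsup_of_frequently_le ?_ hb
  exact ((h γ h1 h2).and_eventually (eventually_ne_atTop 0)).mono fun n hn =>
    le_codimRoot (ha.trans h1.le) hn.2 hn.1

theorem lowerPIExp_le {L : ℝ} (hL : 0 ≤ L)
    (h : ∀ γ > L, ∃ᶠ n in atTop, (codim F A n : ℝ) ≤ γ ^ n) : lowerPIExp F A ≤ L := by
  refine le_of_forall_gt_imp_ge_of_dense fun γ hγ => ?_
  refine liminf_le_of_frequently_le ?_ isBoundedUnder_ge_codimRoot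
  exact ((h γ hγ).and_eventually (eventually_ne_atTop 0)).mono fun n hn =>
    codimRoot_le (hL.trans hγ.le) hn.2 hn.1

theorem le_lowerPIExp {L : ℝ} (hL : 0 < L)
    (hb : IsBoundedUnder (· ≤ ·) atTop (codimRoot F A))
    (h : ∀ γ, 0 < γ → γ < L → ∀ᶠ n in atTop, γ ^ n ≤ (codim F A n : ℝ)) :
    L ≤ lowerPIExp F A := by
  refine le_of_forall_lt_imp_le_of_dense fun δ hδ => ?_
  obtain ⟨γ, h0, h2⟩ := exists_between (max_lt hδ hL)
  refine (le_max_left δ 0).trans (h0.le.trans ?_)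
  have h1 := (le_max_right δ 0).trans_lt h0
  refine le_liminf_of_le hb.isCoboundedUnder_ge ?_
  filter_upwards [h γ h1 h2, eventually_ne_atTop 0] with n h3 h4 using le_codimRoot h1.le h4 h3

theorem not_hasPIExp_of_lt (h : lowerPIExp F A < upperPIExp F A) : ¬ HasPIExp F A := by
  rintro ⟨L, hL⟩
  rw [lowerPIExp, upperPIExp, hL.liminf_eq, hL.limsup_eq] at h
  exact lt_irrefl _ h

end Exponents

/-- A polynomial factor does not change exponential growth. -/
theorem eventually_mul_pow_le {a γ : ℝ} (ha : 0 < a) (h : a < γ) (C : ℝ) :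
    ∀ᶠ n : ℕ in atTop, C * ((n : ℝ) ^ 4 * a ^ n) ≤ γ ^ n := by
  have hγ : 0 < γ := ha.trans h
  have h1 := tendsto_pow_const_mul_const_pow_of_abs_lt_one (r := a / γ) 4
    (by rw [abs_of_pos (by positivity), div_lt_one hγ]; exact h)
  have h2 := h1.const_mul C
  rw [mul_zero] at h2
  filter_upwards [h2.eventually (eventually_le_nhds (zero_lt_one))] with n hn
  rw [div_pow] at hn
  have h3 : C * ((n : ℝ) ^ 4 * (a ^ n / γ ^ n)) = C * ((n : ℝ) ^ 4 * a ^ n) / γ ^ n := by ring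
  rw [h3, div_le_one (by positivity)] at hn
  exact hn

/-! ### The parameters of the blocks -/

/-- The number of letters `1, 2, …` in a block in which they have distance `M`. -/
noncomputable def blockCount (β : ℝ) (M : ℕ) : ℕ := ⌊(β ^ M - 1) / M⌋₊

/-- The length of a block: the largest multiple of the distance `M` that is at most `β ^ M - 1`. -/
noncomputable def blockLength (β : ℝ) (M : ℕ) : ℕ := blockCount β M * M

/-- The distances of the letters in the blocks; each one exceeds the square of the length of the
preceding block. -/
noncomputable def blockGap (β : ℝ) : ℕ → ℕ
  | 0 => 2
  | g + 1 => (blockLength β (blockGap β g) + blockGap β g + 1) ^ 2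

theorem two_le_blockGap (β : ℝ) (g : ℕ) : 2 ≤ blockGap β g := by
  induction g with
  | zero => exact le_rfl
  | succ g ih =>
    rw [blockGap]
    exact (by omega : 2 ≤ _ + _ + 1).trans (Nat.le_self_pow two_ne_zero _)

theorem blockGap_strictMono (β : ℝ) : StrictMono (blockGap β) := by
  refine strictMono_nat_of_lt_succ fun g => ?_
  rw [blockGap]
  exact (by omega : _ < _ + _ + 1).trans_le (Nat.le_self_pow two_ne_zero _)

theorem blockLength_add_one_le {β : ℝ} (hβ : 2 < β) {M : ℕ} (hM : 2 ≤ M) :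
    ((blockLength β M + 1 : ℕ) : ℝ) ≤ β ^ M := by
  have hM' : (0 : ℝ) < M := by norm_cast; omega
  have h1 : 0 ≤ (β ^ M - 1) / M := div_nonneg (sub_nonneg.2 (one_le_pow₀ (by linarith))) hM'.le
  have h2 := Nat.floor_le h1
  rw [le_div_iff₀ hM'] at h2
  rw [blockLength, blockCount]
  push_cast
  linarith

theorem pow_lt_blockLength (β : ℝ) {M : ℕ} (hM : 2 ≤ M) :
    β ^ M < (blockLength β M : ℝ) + M + 1 := by
  have hM' : (0 : ℝ) < M := by norm_cast; omega
  have h2 := Nat.lt_floor_add_one ((β ^ M - 1) / M)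
  rw [div_lt_iff₀ hM'] at h2
  rw [blockLength, blockCount]
  push_cast
  linarith

theorem two_mul_le_pow {β : ℝ} (hβ : 2 < β) {M : ℕ} (hM : 0 < M) : (2 : ℝ) * M ≤ β ^ M := by
  have h1 : 2 * M ≤ 2 ^ M := by
    obtain ⟨k, rfl⟩ : ∃ k, M = k + 1 := ⟨M - 1, by omega⟩
    have := Nat.lt_two_pow_self (n := k)
    rw [pow_succ]; omega
  calc (2 : ℝ) * M ≤ 2 ^ M := by exact_mod_cast h1
    _ ≤ β ^ M := pow_le_pow_left₀ (by norm_num) hβ.le M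

theorem pow_le_two_mul_blockLength {β : ℝ} (hβ : 2 < β) {M : ℕ} (hM : 2 ≤ M) :
    β ^ M ≤ 2 * ((blockLength β M : ℝ) + 1) := by
  have h1 := pow_lt_blockLength β hM
  have h2 := two_mul_le_pow hβ (by omega : 0 < M)
  linarith

theorem le_blockLength_add_one {β : ℝ} (hβ : 2 < β) {M : ℕ} (hM : 2 ≤ M) :
    M ≤ blockLength β M + 1 := by
  have h1 := pow_le_two_mul_blockLength hβ hM
  have h2 := two_mul_le_pow hβ (by omega : 0 < M)
  have : (M : ℝ) ≤ (blockLength β M : ℝ) + 1 := by linarith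
  exact_mod_cast this

/-- A block of gap `M` attains any growth rate `γ < β` in its last degree if `M` is large: each of
the `q` factors of the descending factorial is at least `β ^ M / 4`. -/
theorem pow_le_descFactorial {β γ : ℝ} (hβ : 2 < β) (hγ : 1 ≤ γ) {M : ℕ} (hM : 2 ≤ M)
    (h : 4 * γ ^ (M + 1) ≤ β ^ M) :
    γ ^ (blockLength β M + 1) ≤ ((blockLength β M).descFactorial (blockCount β M) : ℝ) := by
  set q := blockCount β M with hq
  have hN : blockLength β M = q * M := rfl
  have h1 := pow_le_two_mul_blockLength hβ hM
  rw [hN] at h1 ⊢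
  have h2q : 2 * q ≤ q * M := by nlinarith
  have hq1 : 1 ≤ q := by
    by_contra! h0
    have h4 : (4 : ℝ) < β ^ M := by
      calc (4 : ℝ) = 2 ^ 2 := by norm_num
        _ < β ^ 2 := pow_lt_pow_left₀ hβ (by norm_num) (by norm_num)
        _ ≤ β ^ M := pow_le_pow_right₀ (by linarith) hM
    have : q = 0 := by omega
    rw [this] at h1
    norm_num at h1
    linarith
  have h3 : β ^ M ≤ 4 * ((q * M + 1 - q : ℕ) : ℝ) := by
    rw [Nat.cast_sub (by nlinarith)]
    push_cast at h1 ⊢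
    have : (2 : ℝ) * q ≤ q * M := by exact_mod_cast h2q
    linarith
  have h4 : γ ^ (M + 1) ≤ ((q * M + 1 - q : ℕ) : ℝ) := by linarith
  calc γ ^ (q * M + 1) ≤ γ ^ ((M + 1) * q) := pow_le_pow_right₀ hγ (by nlinarith)
    _ = (γ ^ (M + 1)) ^ q := pow_mul _ _ _
    _ ≤ ((q * M + 1 - q : ℕ) : ℝ) ^ q := pow_le_pow_left₀ (by positivity) h4 q
    _ ≤ _ := by exact_mod_cast Nat.pow_sub_le_descFactorial (q * M) q

/-! ### Codimensions of the algebra of blocks -/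

/-- The algebra of the block system with gaps `blockGap β`. -/
abbrev BlockAlg (β : ℝ) (F : Type u) [Field F] : Type u :=
  (blockSystem (blockGap β) fun g => blockLength β (blockGap β g)).Alg F

/-- The square root of `blockGap β (i + 1)`: the first `i + 1` blocks contribute to
the codimensions only below this degree. -/
noncomputable def blockScale (β : ℝ) (i : ℕ) : ℕ := blockLength β (blockGap β i) + blockGap β i + 1

theorem blockGap_succ (β : ℝ) (i : ℕ) : blockGap β (i + 1) = blockScale β i ^ 2 := rfl

theorem blockScale_mono (β : ℝ) : Monotone (blockScale β) := by
  refine monotone_nat_of_le_succ fun i => ?_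
  have h1 : blockScale β i ≤ blockGap β (i + 1) := Nat.le_self_pow two_ne_zero _
  have h2 : blockGap β (i + 1) ≤ blockScale β (i + 1) := by rw [blockScale]; omega
  exact h1.trans h2

theorem le_blockScale (β : ℝ) (i : ℕ) : i ≤ blockScale β i := by
  have := (blockGap_strictMono β).le_apply (x := i)
  rw [blockScale]; omega


/-- This is where the length of a block, just below `β ^ M`, enters the upper bound. -/
theorem pow_div_blockGap_le {β : ℝ} (hβ : 2 < β) {n g : ℕ}
    (hn : n ≤ blockLength β (blockGap β g) + 1) :
    (n : ℝ) ^ ((n - 1) / blockGap β g) ≤ β ^ (n - 1) := by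
  have h1 : (n : ℝ) ≤ β ^ blockGap β g :=
    (Nat.cast_le.2 hn).trans (blockLength_add_one_le hβ (two_le_blockGap β g))
  calc (n : ℝ) ^ ((n - 1) / blockGap β g)
      ≤ (β ^ blockGap β g) ^ ((n - 1) / blockGap β g) :=
        pow_le_pow_left₀ (Nat.cast_nonneg _) h1 _
    _ = β ^ (blockGap β g * ((n - 1) / blockGap β g)) := (pow_mul _ _ _).symm
    _ ≤ β ^ (n - 1) := pow_le_pow_right₀ (by linarith) (Nat.mul_div_le _ _)

theorem blockAlg_finrank_le {β : ℝ} (hβ : 2 < β) (F : Type u) [Field F] (s : Finset ℕ) :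
    (Module.finrank F (monomialSpan F (BlockAlg β F) s.val) : ℝ) ≤
      (s.card : ℝ) ^ 4 * β ^ s.card := by
  refine blockSystem_finrank_le F (fun g => zero_lt_two.trans_le (two_le_blockGap β g)) s
    (one_le_pow₀ (by linarith)) fun g hg => ?_
  exact (pow_div_blockGap_le hβ hg).trans (pow_le_pow_right₀ (by linarith) (Nat.sub_le _ _))

/-- Only the first `i + 1` blocks contribute to the exponential part of the codimensions in
degrees up to `blockGap β (i + 1)`. -/
theorem blockAlg_finrank_le_of_card_le {β : ℝ} (hβ : 2 < β) (F : Type u) [Field F] {s : Finset ℕ}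
    {i : ℕ} (hs : s.card ≤ blockGap β (i + 1)) :
    (Module.finrank F (monomialSpan F (BlockAlg β F) s.val) : ℝ) ≤
      (s.card : ℝ) ^ 4 * β ^ blockScale β i := by
  refine blockSystem_finrank_le F (fun g => zero_lt_two.trans_le (two_le_blockGap β g)) s
    (one_le_pow₀ (by linarith)) fun g hg => ?_
  rcases le_or_gt g i with h | h
  · refine (pow_div_blockGap_le hβ hg).trans (pow_le_pow_right₀ (by linarith) ?_)
    refine le_trans ?_ (blockScale_mono β h)
    rw [blockScale]; omega
  · have h1 := (blockGap_strictMono β).monotone h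
    have h2 := two_le_blockGap β g
    have h3 : i.succ = i + 1 := rfl
    rw [h3] at h1
    rw [Nat.div_eq_of_lt (by omega), pow_zero]
    exact one_le_pow₀ (by linarith)

theorem blockAlg_codim_blockGap_le {β : ℝ} (F : Type u) [Field F] (i : ℕ) :
    (codim F (BlockAlg β F) (blockGap β (i + 1)) : ℝ) ≤ (blockGap β (i + 1) : ℝ) ^ 4 := by
  rw [codim_eq_finrank]
  have := blockSystem_finrank_le F (M := blockGap β) (N := fun g => blockLength β (blockGap β g))
    (fun g => zero_lt_two.trans_le (two_le_blockGap β g))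
    (Finset.range (blockGap β (i + 1))) le_rfl fun g hg => ?_
  · rwa [Finset.card_range, mul_one] at this
  · rw [Finset.card_range] at hg ⊢
    -- The first `i + 1` blocks are too short, and in later ones there is at most one nonzero letter.
    rcases le_or_gt g i with h | h
    · exfalso
      have h1 := blockScale_mono β h
      have h2 : blockLength β (blockGap β g) + 1 < blockScale β g := by
        have := two_le_blockGap β g
        rw [blockScale]; omega
      have h3 : blockScale β i ≤ blockGap β (i + 1) := Nat.le_self_pow two_ne_zero _
      omega
    · have h1 := (blockGap_strictMono β).monotone h
      have h2 := two_le_blockGap β g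
      have h3 : i.succ = i + 1 := rfl
      rw [h3] at h1
      rw [Nat.div_eq_of_lt (by omega), pow_zero]

theorem blockAlg_codim_le {β : ℝ} (hβ : 2 < β) (F : Type u) [Field F] (n : ℕ) :
    (codim F (BlockAlg β F) n : ℝ) ≤ (n : ℝ) ^ 4 * β ^ n := by
  rw [codim_eq_finrank]
  have := blockAlg_finrank_le hβ F (Finset.range n)
  rwa [Finset.card_range] at this

theorem blockAlg_codim_unitization_le {β : ℝ} (hβ : 2 < β) (F : Type u) [Field F] {n : ℕ}
    (hn : n ≠ 0) :
    (codim F (Unitization F (BlockAlg β F)) n : ℝ) ≤ 2 * ((n : ℝ) ^ 4 * (β + 1) ^ n) := by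
  have h1 : (codim F (Unitization F (BlockAlg β F)) n : ℝ) ≤ 1 + ∑ T ∈ (Finset.range n).powerset,
      (Module.finrank F (monomialSpan F (BlockAlg β F) T.val) : ℝ) := by
    exact_mod_cast codim_unitization_le F (BlockAlg β F) n
  have h2 : ∑ T ∈ (Finset.range n).powerset,
      (Module.finrank F (monomialSpan F (BlockAlg β F) T.val) : ℝ) ≤
      ∑ T ∈ (Finset.range n).powerset, (n : ℝ) ^ 4 * β ^ T.card := by
    refine Finset.sum_le_sum fun T hT => (blockAlg_finrank_le hβ F T).trans ?_
    have h3 := Finset.card_le_card (Finset.mem_powerset.1 hT)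
    rw [Finset.card_range] at h3
    have h4 : (T.card : ℝ) ≤ n := by exact_mod_cast h3
    gcongr
  have h3 : ∑ T ∈ (Finset.range n).powerset, (n : ℝ) ^ 4 * β ^ T.card =
      (n : ℝ) ^ 4 * (β + 1) ^ n := by
    have := Finset.sum_pow_mul_eq_add_pow β 1 (Finset.range n)
    simp only [one_pow, mul_one, Finset.card_range] at this
    rw [← Finset.mul_sum, this]
  have h4 : 1 ≤ (n : ℝ) ^ 4 * (β + 1) ^ n := by
    refine one_le_mul_of_one_le_of_one_le (one_le_pow₀ ?_) (one_le_pow₀ (by linarith))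
    exact_mod_cast Nat.one_le_iff_ne_zero.2 hn
  linarith

theorem blockAlg_codim_unitization_blockGap_le {β : ℝ} (hβ : 2 < β) (F : Type u) [Field F]
    (i : ℕ) : (codim F (Unitization F (BlockAlg β F)) (blockGap β (i + 1)) : ℝ) ≤
      2 * ((blockGap β (i + 1) : ℝ) ^ 4 * (2 ^ blockGap β (i + 1) * β ^ blockScale β i)) := by
  set n := blockGap β (i + 1) with hn
  have hn2 : 2 ≤ n := two_le_blockGap β (i + 1)
  have h1 : (codim F (Unitization F (BlockAlg β F)) n : ℝ) ≤ 1 + ∑ T ∈ (Finset.range n).powerset,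
      (Module.finrank F (monomialSpan F (BlockAlg β F) T.val) : ℝ) := by
    exact_mod_cast codim_unitization_le F (BlockAlg β F) n
  have h2 : ∑ T ∈ (Finset.range n).powerset,
      (Module.finrank F (monomialSpan F (BlockAlg β F) T.val) : ℝ) ≤
      ∑ T ∈ (Finset.range n).powerset, (n : ℝ) ^ 4 * β ^ blockScale β i := by
    refine Finset.sum_le_sum fun T hT => ?_
    have h3 := Finset.card_le_card (Finset.mem_powerset.1 hT)
    rw [Finset.card_range] at h3
    refine (blockAlg_finrank_le_of_card_le hβ F h3).trans ?_
    have h4 : (T.card : ℝ) ≤ n := by exact_mod_cast h3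
    gcongr
  rw [Finset.sum_const, Finset.card_powerset, Finset.card_range, nsmul_eq_mul] at h2
  push_cast at h2
  have h4 : 1 ≤ (n : ℝ) ^ 4 * (2 ^ n * β ^ blockScale β i) := by
    refine one_le_mul_of_one_le_of_one_le (one_le_pow₀ ?_)
      (one_le_mul_of_one_le_of_one_le (one_le_pow₀ (by norm_num)) (one_le_pow₀ (by linarith)))
    exact_mod_cast (by omega : 1 ≤ n)
  nlinarith

theorem blockAlg_le_codim {β γ : ℝ} (hβ : 2 < β) (F : Type u) [Field F] (hγ : 1 ≤ γ) {g : ℕ}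
    (h : 4 * γ ^ (blockGap β g + 1) ≤ β ^ blockGap β g) :
    γ ^ (blockLength β (blockGap β g) + 1) ≤
      (codim F (BlockAlg β F) (blockLength β (blockGap β g) + 1) : ℝ) := by
  refine (pow_le_descFactorial hβ hγ (two_le_blockGap β g) h).trans ?_
  exact_mod_cast blockSystem_descFactorial_le_codim (M := blockGap β)
    (N := fun g => blockLength β (blockGap β g)) F g (blockCount β (blockGap β g))
    (zero_lt_two.trans_le (two_le_blockGap β g)) rfl

/-! ### The exponents of the algebra of blocks -/

theorem tendsto_blockGap_succ (β : ℝ) : Tendsto (fun i => blockGap β (i + 1)) atTop atTop :=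
  (blockGap_strictMono β).tendsto_atTop.comp (tendsto_add_atTop_nat 1)

theorem blockAlg_eventually_codim_le {β γ : ℝ} (hβ : 2 < β) (F : Type u) [Field F] (hγ : β < γ) :
    ∀ᶠ n in atTop, (codim F (BlockAlg β F) n : ℝ) ≤ γ ^ n := by
  filter_upwards [eventually_mul_pow_le (by linarith) hγ 1] with n hn
  rw [one_mul] at hn
  exact (blockAlg_codim_le hβ F n).trans hn

theorem blockAlg_eventually_codim_unitization_le {β γ : ℝ} (hβ : 2 < β) (F : Type u) [Field F]
    (hγ : β + 1 < γ) :
    ∀ᶠ n in atTop, (codim F (Unitization F (BlockAlg β F)) n : ℝ) ≤ γ ^ n := by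
  filter_upwards [eventually_mul_pow_le (by linarith) hγ 2, eventually_ne_atTop 0] with n hn h0
  exact (blockAlg_codim_unitization_le hβ F h0).trans hn

theorem blockAlg_lowerPIExp {β : ℝ} (hβ : 2 < β) (F : Type u) [Field F] :
    lowerPIExp F (BlockAlg β F) = 1 := by
  refine le_antisymm (lowerPIExp_le zero_le_one fun γ hγ => ?_) ?_
  · refine (tendsto_blockGap_succ β).frequently (Eventually.frequently ?_)
    filter_upwards [(tendsto_blockGap_succ β).eventually
      (eventually_mul_pow_le zero_lt_one hγ 1)] with i hi
    rw [one_mul, one_pow, mul_one] at hi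
    exact (blockAlg_codim_blockGap_le F i).trans hi
  · refine le_lowerPIExp zero_lt_one (isBoundedUnder_le_codimRoot (by linarith)
      (blockAlg_eventually_codim_le hβ F (lt_add_one β))) fun γ h0 h1 => ?_
    filter_upwards [eventually_ne_atTop 0] with n hn
    obtain ⟨k, rfl⟩ := Nat.exists_eq_succ_of_ne_zero hn
    refine (pow_le_one₀ h0.le h1.le).trans ?_
    exact_mod_cast blockSystem_one_le_codim F k

theorem blockAlg_upperPIExp {β : ℝ} (hβ : 2 < β) (F : Type u) [Field F] :
    upperPIExp F (BlockAlg β F) = β := by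
  refine le_antisymm (upperPIExp_le (by linarith) fun γ hγ =>
    blockAlg_eventually_codim_le hβ F hγ) ?_
  refine le_upperPIExp zero_le_one (by linarith) (isBoundedUnder_le_codimRoot (by linarith)
      (blockAlg_eventually_codim_le hβ F (lt_add_one β))) fun γ h1 h2 => ?_
  have hγ : 0 < γ := by linarith
  have ht : Tendsto (fun g => blockLength β (blockGap β g) + 1) atTop atTop :=
    tendsto_atTop_mono (fun g => le_blockLength_add_one hβ (two_le_blockGap β g))
      (blockGap_strictMono β).tendsto_atTop
  refine ht.frequently (Eventually.frequently ?_)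
  have h3 : Tendsto (fun g => (β / γ) ^ blockGap β g) atTop atTop :=
    (tendsto_pow_atTop_atTop_of_one_lt ((one_lt_div hγ).2 h2)).comp
      (blockGap_strictMono β).tendsto_atTop
  filter_upwards [h3.eventually (eventually_ge_atTop (4 * γ))] with g hg
  refine blockAlg_le_codim hβ F h1.le ?_
  rw [div_pow, le_div_iff₀ (by positivity)] at hg
  calc 4 * γ ^ (blockGap β g + 1) = 4 * γ * γ ^ blockGap β g := by ring
    _ ≤ _ := hg

theorem blockAlg_lowerPIExp_unitization {β : ℝ} (hβ : 2 < β) (F : Type u) [Field F] :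
    lowerPIExp F (Unitization F (BlockAlg β F)) = 2 := by
  refine le_antisymm (lowerPIExp_le zero_le_two fun γ hγ => ?_) ?_
  · obtain ⟨δ, h1, h2⟩ := exists_between (show (2 : ℝ) < γ from hγ)
    have hδ : 0 < δ := by linarith
    refine (tendsto_blockGap_succ β).frequently (Eventually.frequently ?_)
    have h3 : Tendsto (fun i => (δ / 2) ^ blockScale β i) atTop atTop :=
      (tendsto_pow_atTop_atTop_of_one_lt ((one_lt_div two_pos).2 h1)).comp
        (tendsto_atTop_mono (le_blockScale β) tendsto_id)
    filter_upwards [(tendsto_blockGap_succ β).eventually (eventually_mul_pow_le hδ h2 2),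
      h3.eventually (eventually_ge_atTop β)] with i hi hi'
    refine (blockAlg_codim_unitization_blockGap_le hβ F i).trans (le_trans ?_ hi)
    -- The gap is the square of the scale, so `β ^ scale` is absorbed by `(δ / 2) ^ gap`.
    have h4 : β ^ blockScale β i ≤ (δ / 2) ^ blockGap β (i + 1) := by
      rw [blockGap_succ, sq, pow_mul]
      exact pow_le_pow_left₀ (by linarith) hi' _
    have h5 : (2 : ℝ) ^ blockGap β (i + 1) * β ^ blockScale β i ≤ δ ^ blockGap β (i + 1) := by
      calc _ ≤ (2 : ℝ) ^ blockGap β (i + 1) * (δ / 2) ^ blockGap β (i + 1) := by gcongr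
        _ = δ ^ blockGap β (i + 1) := by rw [← mul_pow]; congr 1; ring
    gcongr
  · refine le_lowerPIExp two_pos (isBoundedUnder_le_codimRoot (by linarith)
      (blockAlg_eventually_codim_unitization_le hβ F (lt_add_one (β + 1)))) fun γ h0 h1 => ?_
    filter_upwards [eventually_mul_pow_le h0 h1 2, eventually_ne_atTop 0] with n hn hn0
    obtain ⟨k, rfl⟩ := Nat.exists_eq_succ_of_ne_zero hn0
    have h2 : (2 : ℝ) ^ k ≤ codim F (Unitization F (BlockAlg β F)) (k + 1) := by
      exact_mod_cast blockSystem_two_pow_le_codim_unitization F k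
    refine le_trans ?_ h2
    have h3 : (1 : ℝ) ≤ ((k.succ : ℕ) : ℝ) ^ 4 := one_le_pow₀ (by norm_cast; omega)
    have h4 : 0 < γ ^ k.succ := by positivity
    rw [pow_succ 2 k] at hn
    nlinarith


theorem corollary1 (F : Type u) [Field F] [CharZero F] (β : ℝ) (hβ : 2 < β) :
    ∃ (R : Type u) (_ : NonUnitalNonAssocRing R) (_ : Module F R)
      (_ : IsScalarTower F R R) (_ : SMulCommClass F R R),
      (CodimExpBounded F R ∧ lowerPIExp F R = 1 ∧ upperPIExp F R = β) ∧
      CodimExpBounded F (Unitization F R) ∧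
      ¬ HasPIExp F (Unitization F R) ∧
      lowerPIExp F (Unitization F R) = 2 ∧
      β ≤ upperPIExp F (Unitization F R) ∧
      upperPIExp F (Unitization F R) ≤ β + 1 := by
  have hb := blockAlg_eventually_codim_unitization_le hβ F (lt_add_one (β + 1))
  have hup : β ≤ upperPIExp F (Unitization F (BlockAlg β F)) := by
    refine (blockAlg_upperPIExp hβ F).ge.trans ?_
    refine limsup_le_limsup (Eventually.of_forall fun n => ?_)
      isBoundedUnder_ge_codimRoot.isCoboundedUnder_le
      (isBoundedUnder_le_codimRoot (by linarith) hb)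
    refine Real.rpow_le_rpow (Nat.cast_nonneg _) ?_ (by positivity)
    exact_mod_cast codim_le_codim_unitization F (BlockAlg β F) n
  have hlow := blockAlg_lowerPIExp_unitization hβ F
  have hR : CodimExpBounded F (BlockAlg β F) := codimExpBounded_of_eventually (by linarith)
    (blockAlg_eventually_codim_le hβ F (lt_add_one β))
  have hU : CodimExpBounded F (Unitization F (BlockAlg β F)) :=
    codimExpBounded_of_eventually (by linarith) hb
  have hno : ¬ HasPIExp F (Unitization F (BlockAlg β F)) :=
    not_hasPIExp_of_lt (by rw [hlow]; linarith)
  have hle : upperPIExp F (Unitization F (BlockAlg β F)) ≤ β + 1 :=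
    upperPIExp_le (by linarith) fun γ hγ => blockAlg_eventually_codim_unitization_le hβ F hγ
  exact ⟨BlockAlg β F, inferInstance, inferInstance, inferInstance, inferInstance,
    ⟨hR, blockAlg_lowerPIExp hβ F, blockAlg_upperPIExp hβ F⟩, hU, hno, hlow, hup, hle⟩
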